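/- In online sorting, items $x_1,\dots,x_n\in[0,1]$ arrive one by one, and each must be placed immediately and irrevocably into an empty cell of an array $A$ with $n$ cells; the cost is $\sum_{k=1}^{n-1}|A[k+1]-A[k]|$. In the stochastic version the items are independent and uniform on $[0,1]$. Consider the following deterministic, non-recursive online algorithm (adaptive allocation with merging). Let $K=\lceil\log^8 n\rceil$, let $B_1$ be the largest power of $K$ with $B_1K\le n$ (and $B_1=1$ if there is none), let $m(N,B)=\lceil N/B-\tfrac12(N/B)^{2/3}\rceil$, and call $[(i-1)/B,i/B]$, $1\le i\le B$, the segments for $B$. A buffer is a subarray allocated to one segment (its initial segment) and accepts exactly the items of that segment; the unallocated suffix of the array is the pool, and new buffers are allocated from its front, in increasing order of their segments. The remaining capacity $c_i$ of a current segment $i$ is the number of empty cells in all buffers whose initial segment is contained in it. Phase $1$ starts by allocating a buffer of size $m(n,B_1)$ to each of the $B_1$ segments. A phase $j-1$ that is not the last one ends as soon as some current segment has remaining capacity $0$. Let $n_j$ be the number of future items at that moment. Phase $j$ begins by allocating to every segment $i$ for $B_{j-1}$ a (regular) buffer of size $m(n_j,B_{j-1})-c_i$. Then: (a) if the pool has at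 least $B_{j-1}K$ cells, put $B_j=B_{j-1}$; (b) if it has fewer and $B_{j-1}>K$, put $B_j=B_{j-1}/K$ (every $K$ adjacent segments are merged) and allocate to each segment for $B_j$ a (dampening) buffer of size $m(n_j,B_j)-K\,m(n_j,B_{j-1})$; (c) otherwise put $B_j=B_{j-1}$; phase $j$ is the last phase, and its pool is the final pool. Each item is placed into the first empty cell of the oldest non-full buffer that accepts it, or, if there is none and the phase is the last one, into the first empty cell of the final pool. The algorithm fails if $n_j/B_{j-1}>(n_{j-1}/B_{j-1})^{2/3}$ for some $j>1$, if some new buffer has nonpositive size or the new buffers do not fit into the pool, or if no cell is found for an item by the above rule; from then on each item (including the one that caused the failure) is placed into the first empty cell of the array. Theorem. There are constants $C>0$ and $c\in\mathbb N$ such that for every $n\ge1$, with probability at least $1-C/n^{10}$ over the stochastic input, all of the following hold: the algorithm does not fail and reaches its last phase, its cost is at most $C\log^c n$, every buffer and the final pool have at most $C\log^c n$ cells, and the number of phases is at most $C\log n/\log\log n$. In particular, there is a deterministic algorithm for stochastic online sorting that achieves cost $\mathrm{poly}\log n$ with probability $1-O(1/n^{10})$. -/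

import Mathlib

/-! # Online sorting and the adaptive-allocation-with-merging algorithm

Items and cells are numbered from `0`. -/

namespace OnlineSorting

/-! ## The problem -/

/-- A deterministic online algorithm for sorting `n` items into `n` cells: `place x t` is the cell
that receives the `t`-th item of the stream `x`. Every cell receives exactly one item, so the map
`t ↦ place x t` is a permutation, and the chosen cell depends only on the items that have arrived
so far. -/
structure Algorithm (n : ℕ) where
  place : (Fin n → ℝ) → Equiv.Perm (Fin n)
  causal : ∀ (x y : Fin n → ℝ) (t : Fin n), (∀ s ≤ t, x s = y s) → place x t = place y t

/-- The final contents of the array. -/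
def Algorithm.array {n : ℕ} (alg : Algorithm n) (x : Fin n → ℝ) (k : Fin n) : ℝ :=
  x ((alg.place x).symm k)

/-- The sum of absolute differences between adjacent cells of a filled array. -/
noncomputable def adjacentCost {n : ℕ} (A : Fin n → ℝ) : ℝ :=
  ∑ k : Fin n, if h : (k : ℕ) + 1 < n then |A ⟨k + 1, h⟩ - A k| else 0

/-- The cost of an algorithm on a stream. -/
noncomputable def Algorithm.cost {n : ℕ} (alg : Algorithm n) (x : Fin n → ℝ) : ℝ :=
  adjacentCost (alg.array x)

/-- The law of a stream of `n` independent uniformly random items of `[0, 1]`. -/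
noncomputable def streamLaw (n : ℕ) : MeasureTheory.Measure (Fin n → ℝ) :=
  MeasureTheory.Measure.pi fun _ => MeasureTheory.volume.restrict (Set.Icc (0 : ℝ) 1)

/-! ## Parameters of the algorithm -/

/-- The merging parameter `K = ⌈log ^ 8 n⌉`. -/
noncomputable def mergeParam (n : ℕ) : ℕ := ⌈Real.log n ^ 8⌉₊

/-- The initial number of segments: the largest power `B` of `K` such that `B * K ≤ n`
(and `1` if there is none). -/
noncomputable def initialSegments (n : ℕ) : ℕ := mergeParam n ^ Nat.log (mergeParam n) (n / mergeParam n)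

/-- The prediction `⌈N / B - (N / B) ^ (2 / 3) / 2⌉` for the number of items from each of `B`
segments, if `N` items are still to come. -/
noncomputable def prediction (N B : ℕ) : ℕ :=
  ⌈(N : ℝ) / B - 1 / 2 * ((N : ℝ) / B) ^ (2 / 3 : ℝ)⌉₊

/-- The index `i` of the segment `[i / B, (i + 1) / B)` that contains the item `x` of `[0, 1]`
(the last segment also contains `1`). -/
noncomputable def segmentOf (B : ℕ) (x : ℝ) : ℕ := min ⌊x * B⌋₊ (B - 1)

/-- A buffer: the subarray of `size` cells that begins at cell `start`, allocated to the segment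
with index `seg` among `numSeg` segments (its initial segment). -/
structure Buffer where
  start : ℕ
  size : ℕ
  numSeg : ℕ
  seg : ℕ

/-- A buffer accepts the items of its initial segment. -/
def Buffer.Accepts (b : Buffer) (x : ℝ) : Prop := segmentOf b.numSeg x = b.seg

/-- The initial segment `[seg / numSeg, (seg + 1) / numSeg]` of the buffer is contained in the
segment `[i / B, (i + 1) / B]`. -/
def Buffer.BelongsTo (b : Buffer) (B i : ℕ) : Prop :=
  i * b.numSeg ≤ b.seg * B ∧ (b.seg + 1) * B ≤ (i + 1) * b.numSeg

/-- The state of the algorithm. -/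
structure State (n : ℕ) where
  /-- the contents of the array -/
  cells : Fin n → Option ℝ
  /-- the buffers, oldest first -/
  buffers : List Buffer
  /-- the pool consists of the cells from `poolStart` on -/
  poolStart : ℕ
  /-- the number of segments in the current phase -/
  numSeg : ℕ
  /-- the index of the current phase, starting at `1` -/
  phase : ℕ
  /-- the number of future items at the start of the current phase -/
  phaseItems : ℕ
  /-- the current phase is the last one, so the pool is the final pool -/
  last : Bool
  /-- the algorithm is in its failure mode -/
  failed : Bool

/-- The first empty cell among the `len` cells that begin at cell `start`, if there is one. -/
def firstEmpty {n : ℕ} (cells : Fin n → Option ℝ) (start len : ℕ) : Option (Fin n) :=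
  (List.finRange n).find? fun k =>
    decide (start ≤ (k : ℕ)) && decide ((k : ℕ) < start + len) && (cells k).isNone

/-- The number of empty cells among the `len` cells that begin at cell `start`. -/
def emptyCount {n : ℕ} (cells : Fin n → Option ℝ) (start len : ℕ) : ℕ :=
  (Finset.univ.filter fun k : Fin n =>
    start ≤ (k : ℕ) ∧ (k : ℕ) < start + len ∧ (cells k).isNone = true).card

open Classical in
/-- The remaining capacity of the current segment `i`: the number of empty cells in all buffers
that belong to it. -/
noncomputable def State.capacity {n : ℕ} (st : State n) (i : ℕ) : ℕ :=
  ((st.buffers.filter fun b => decide (b.BelongsTo st.numSeg i)).map fun b =>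
    emptyCount st.cells b.start b.size).sum

/-- One new buffer for each of `B` segments, where the buffer of segment `i` has `size i` cells,
in increasing order of the segments, from cell `start` on. -/
def allocate (start B : ℕ) (size : ℕ → ℕ) : List Buffer :=
  (List.range B).map fun i => ⟨start + ∑ k ∈ Finset.range i, size k, size i, B, i⟩

/-! ## The algorithm -/

/-- The start of the first phase: one buffer for each initial segment. -/
noncomputable def initialState (n : ℕ) : State n where
  cells := fun _ => none
  buffers := allocate 0 (initialSegments n) fun _ => prediction n (initialSegments n)
  poolStart := initialSegments n * prediction n (initialSegments n)
  numSeg := initialSegments n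
  phase := 1
  phaseItems := n
  last := false
  failed := false

/-- Entering the failure mode. -/
def State.fail {n : ℕ} (st : State n) : State n := { st with failed := true }

/-- The merge subroutine, run after the adaptive allocation of a phase that starts with `N` future
items and in which every old segment has remaining capacity `mOld`: every `K` adjacent segments
become one segment, which gets a dampening buffer from the pool. It fails if a dampening buffer
would have nonpositive size (or if the dampening buffers do not fit into the pool). -/
noncomputable def State.merge {n : ℕ} (st : State n) (N mOld : ℕ) : State n :=
  let K := mergeParam n
  let B := st.numSeg / K
  let m := prediction N B
  if m ≤ K * mOld ∨ n < st.poolStart + B * (m - K * mOld) then st.fail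
  else
    { st with
      buffers := st.buffers ++ allocate st.poolStart B fun _ => m - K * mOld
      poolStart := st.poolStart + B * (m - K * mOld)
      numSeg := B }

open Classical in
/-- The start of a new phase. The algorithm fails if the number of future items did not decrease
enough during the phase that ends, or if a new regular buffer would have nonpositive size (or if
the regular buffers do not fit into the pool). Otherwise it allocates a regular buffer for each
segment, and after that it decides by the size of the pool whether to go on with the same segments,
to merge segments, or to make the new phase the last one. -/
noncomputable def State.newPhase {n : ℕ} (st : State n) : State n :=
  let K := mergeParam n
  let B := st.numSeg
  let N := emptyCount st.cells 0 n
  let mOld := prediction N B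
  let size : ℕ → ℕ := fun i => mOld - st.capacity i
  let start := st.poolStart + ∑ i ∈ Finset.range B, size i
  if ((st.phaseItems : ℝ) / B) ^ (2 / 3 : ℝ) < (N : ℝ) / B then st.fail
  else if ∃ i < B, mOld ≤ st.capacity i then st.fail
  else if n < start then st.fail
  else
    let next : State n :=
      { st with
        buffers := st.buffers ++ allocate st.poolStart B size
        poolStart := start
        phase := st.phase + 1
        phaseItems := N }
    if B * K ≤ n - start then next
    else if K < B then next.merge N mOld
    else { next with last := true }

open Classical in
/-- The cell of the item `x` outside the failure mode: the first empty cell of the oldest non-full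
buffer that accepts `x`; if there is none, and the current phase is the last one, the first empty
cell of the final pool. -/
noncomputable def State.regularCell {n : ℕ} (st : State n) (x : ℝ) : Option (Fin n) :=
  if st.failed then none
  else
    (st.buffers.findSome? fun b =>
      if b.Accepts x then firstEmpty st.cells b.start b.size else none).or
    (if st.last then firstEmpty st.cells st.poolStart (n - st.poolStart) else none)

/-- The cell of the item `x`; in the failure mode, this is the first empty cell of the array. -/
noncomputable def State.cellFor {n : ℕ} (st : State n) (x : ℝ) : Option (Fin n) :=
  (st.regularCell x).or (firstEmpty st.cells 0 n)

/-- Placing the item `x`. The algorithm enters the failure mode if there is no regular cell. -/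
noncomputable def State.insertItem {n : ℕ} (st : State n) (x : ℝ) : State n :=
  match st.cellFor x with
  | none => st
  | some k =>
    { st with
      cells := Function.update st.cells k (some x)
      failed := st.failed || (st.regularCell x).isNone }

open Classical in
/-- Processing the item `x`: it is placed, and a phase that is not the last one ends when the
remaining capacity of some current segment is `0`. -/
noncomputable def State.step {n : ℕ} (st : State n) (x : ℝ) : State n :=
  let st' := st.insertItem x
  if st'.failed = false ∧ st'.last = false ∧ ∃ i < st'.numSeg, st'.capacity i = 0 then st'.newPhase
  else st'

/-- The state after the first `t` items of the stream `x`. -/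
noncomputable def run {n : ℕ} (x : Fin n → ℝ) : ℕ → State n
  | 0 => initialState n
  | t + 1 => if h : t < n then (run x t).step (x ⟨t, h⟩) else run x t

/-! ## Each item is placed into an empty cell -/

theorem firstEmpty_isNone {n : ℕ} {cells : Fin n → Option ℝ} {s l : ℕ} {k : Fin n}
    (h : firstEmpty cells s l = some k) : cells k = none := by
  have := List.find?_some h
  simp at this
  exact this.2

theorem cellFor_isNone {n : ℕ} {st : State n} {x : ℝ} {k : Fin n} (h : st.cellFor x = some k) :
    st.cells k = none := by
  unfold State.cellFor at h
  rw [Option.or_eq_some_iff] at h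
  rcases h with h | ⟨-, h⟩
  · unfold State.regularCell at h
    split_ifs at h
    · rw [Option.or_eq_some_iff] at h
      rcases h with h | ⟨-, h⟩
      · obtain ⟨b, -, hb⟩ := List.exists_of_findSome?_eq_some h
        split_ifs at hb
        exact firstEmpty_isNone hb
      · exact firstEmpty_isNone h
    · rw [Option.or_eq_some_iff] at h
      rcases h with h | ⟨-, h⟩
      · obtain ⟨b, -, hb⟩ := List.exists_of_findSome?_eq_some h
        split_ifs at hb
        exact firstEmpty_isNone hb
      · simp at h
  · exact firstEmpty_isNone h

theorem cellFor_isSome {n : ℕ} {st : State n} (x : ℝ) {k : Fin n} (h : st.cells k = none) :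
    ∃ k', st.cellFor x = some k' := by
  rw [← Option.isSome_iff_exists]
  unfold State.cellFor
  rw [Option.isSome_or]
  have : (firstEmpty st.cells 0 n).isSome = true := by
    unfold firstEmpty
    rw [List.find?_isSome]
    exact ⟨k, List.mem_finRange k, by simp [h]⟩
  simp [this]

theorem merge_cells {n : ℕ} (st : State n) (N m : ℕ) : (st.merge N m).cells = st.cells := by
  unfold State.merge
  dsimp only
  split_ifs <;> rfl

theorem newPhase_cells {n : ℕ} (st : State n) : st.newPhase.cells = st.cells := by
  unfold State.newPhase
  dsimp only
  split_ifs <;> simp [State.fail, merge_cells]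

theorem step_cells {n : ℕ} {st : State n} {x : ℝ} {k : Fin n} (h : st.cellFor x = some k) :
    (st.step x).cells = Function.update st.cells k (some x) := by
  have h' : (st.insertItem x).cells = Function.update st.cells k (some x) := by
    unfold State.insertItem
    rw [h]
  unfold State.step
  dsimp only
  split_ifs
  · rw [newPhase_cells, h']
  · exact h'

/-- After `t ≤ n` items exactly `t` cells are filled. -/
theorem card_filled {n : ℕ} (x : Fin n → ℝ) (t : ℕ) (ht : t ≤ n) :
    (Finset.univ.filter fun k => (run x t).cells k ≠ none).card = t := by
  induction t with
  | zero => simp [run, initialState]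
  | succ t ih =>
    have ih := ih (by omega)
    have hlt : t < n := by omega
    obtain ⟨k, hk⟩ : ∃ k, (run x t).cells k = none := by
      by_contra hcon
      push Not at hcon
      rw [Finset.filter_true_of_mem (fun k _ => hcon k)] at ih
      simp at ih
      omega
    obtain ⟨c, hc⟩ := cellFor_isSome (x ⟨t, hlt⟩) hk
    have hcn := cellFor_isNone hc
    have hrun : (run x (t + 1)).cells = Function.update (run x t).cells c (some (x ⟨t, hlt⟩)) := by
      rw [run, dif_pos hlt, step_cells hc]
    have hset : (Finset.univ.filter fun k => (run x (t + 1)).cells k ≠ none)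
        = insert c (Finset.univ.filter fun k => (run x t).cells k ≠ none) := by
      ext k
      by_cases hkc : k = c
      · subst hkc
        simp [hrun]
      · simp [hrun, hkc]
    rw [hset, Finset.card_insert_of_notMem (by simp [hcn]), ih]

theorem exists_cell {n : ℕ} (x : Fin n → ℝ) (t : Fin n) :
    ∃ k, (run x t).cellFor (x t) = some k := by
  obtain ⟨k, hk⟩ : ∃ k, (run x t).cells k = none := by
    by_contra hcon
    push Not at hcon
    have h := card_filled x t t.2.le
    rw [Finset.filter_true_of_mem (fun k _ => hcon k)] at h
    simp at h
    have := t.2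
    omega
  exact cellFor_isSome _ hk

/-- The cell that receives the `t`-th item. -/
noncomputable def cell {n : ℕ} (x : Fin n → ℝ) (t : Fin n) : Fin n :=
  ((run x t).cellFor (x t)).get (Option.isSome_iff_exists.2 (exists_cell x t))

theorem cellFor_cell {n : ℕ} (x : Fin n → ℝ) (t : Fin n) :
    (run x t).cellFor (x t) = some (cell x t) := by
  simp [cell]

theorem run_succ_cells {n : ℕ} (x : Fin n → ℝ) (t : Fin n) :
    (run x (t + 1)).cells = Function.update (run x t).cells (cell x t) (some (x t)) := by
  rw [run, dif_pos t.2, step_cells (cellFor_cell x t)]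

theorem cell_filled {n : ℕ} (x : Fin n → ℝ) (s : Fin n) (t : ℕ) (hst : (s : ℕ) < t) (ht : t ≤ n) :
    (run x t).cells (cell x s) ≠ none := by
  induction t with
  | zero => omega
  | succ t ih =>
    have h := run_succ_cells x ⟨t, ht⟩
    dsimp only at h
    rw [h]
    by_cases hc : cell x s = cell x ⟨t, ht⟩
    · rw [hc]
      simp
    · rw [Function.update_of_ne hc]
      refine ih ?_ (by omega)
      by_contra hcon
      have : s = ⟨t, ht⟩ := Fin.ext (by simp; omega)
      exact hc (by rw [this])

theorem cell_injective {n : ℕ} (x : Fin n → ℝ) : Function.Injective (cell x) := by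
  have key : ∀ s t : Fin n, s < t → cell x s ≠ cell x t := by
    intro s t hst h
    refine cell_filled x s t hst t.2.le ?_
    rw [h]
    exact cellFor_isNone (cellFor_cell x t)
  intro s t h
  rcases lt_trichotomy s t with hst | hst | hst
  · exact absurd h (key s t hst)
  · exact hst
  · exact absurd h.symm (key t s hst)

theorem run_congr {n : ℕ} (x y : Fin n → ℝ) (t : ℕ) (h : ∀ s : Fin n, (s : ℕ) < t → x s = y s) :
    run x t = run y t := by
  induction t with
  | zero => rfl
  | succ t ih =>
    rw [run, run, ih fun s hs => h s (by omega)]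
    split_ifs with ht
    · rw [h ⟨t, ht⟩ (by simp)]
    · rfl

/-- The adaptive-allocation-with-merging algorithm. -/
noncomputable def adaptMerge (n : ℕ) : Algorithm n where
  place x := Equiv.ofBijective (cell x) (Finite.injective_iff_bijective.1 (cell_injective x))
  causal x y t h := by
    have h1 : (run x t).cellFor (x t) = (run y t).cellFor (y t) := by
      rw [run_congr x y t fun s hs => h s (le_of_lt hs), h t le_rfl]
    rw [cellFor_cell, cellFor_cell] at h1
    simpa using h1

/-- The state in which the algorithm ends. -/
noncomputable def finalState {n : ℕ} (x : Fin n → ℝ) : State n := run x n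

/-- The size of the pool. -/
def State.poolSize {n : ℕ} (st : State n) : ℕ := n - st.poolStart

end OnlineSorting

/-! The proof separates chance from the algorithm. Write `K = mergeParam n` and let `m(N, B)` be the
prediction. A stream is `Good` if all its items lie in `[0, 1]` and, for all `B`, `i`, `s`, `t`
with `(n - s) / B ≥ K ^ (2 / 3) / 4`, the number of items of the segment `i` for `B` that arrive
between the times `s` and `t` deviates from `(t - s) / B` by at most `((n - s) / B) ^ (2 / 3) / 20`.
A Chernoff bound (`streamLaw_deviation_le`) and a union bound over all `B`, `i`, `s`, `t`
(`streamLaw_not_good_le`) show that a stream fails to be good with probability `O(1 / n ^ 11)`. As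
all periods are covered, it does not matter that the phases begin at random times.

On a good stream the run is controlled by a deterministic invariant (`Core`, `Inv`, `inv_run`).
Consider a phase that starts with `N` future items and `B` segments, and let `M = N / B`, which is
at least `K` unless the phase is the last one. The predictions fall short of `M` by
`M ^ (2 / 3) / 2`, far more than the fluctuations. So when the phase ends, between
`M ^ (2 / 3) / 4` and `M ^ (2 / 3)` items per segment are left, and the segments differ so little
that all regular buffers have positive sizes; the buffers fit into the pool because
`B * m(N, B) ≤ N`, and `N` is the number of empty cells (`Inv.newPhase`, `inv_merge`). In each phase
but the last, the number of future items drops by a factor `K ^ (1 / 3)`, which bounds the number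
of phases.

After a merge, an item may find its own buffers full while other buffers of its current segment are
not. This does no harm as long as the dampening buffer has empty cells, and a full dampening buffer
means that one of the merged segments received far more items than predicted; then all of them
received as many as predicted, so that all their buffers are full and the phase ends
(`Core.fine_le_segCount`, `Core.exists_buffer`). In the last phase every segment eventually fills
its buffers, and therefore the final pool has room for exactly the remaining items
(`Core.pool_ne_zero`).

Each allocation of one buffer per segment contributes `O(K ^ 3)` to the cost, because its buffers
are sorted by segments and have at most `K ^ 3` cells (`Batches.sum_gap_le`), there are at most two
allocations per phase, and the final pool has at most `K ^ 2` cells. -/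

namespace OnlineSorting


/-! ### Segments and item counts -/

theorem segmentOf_lt {B : ℕ} (hB : 0 < B) (x : ℝ) : segmentOf B x < B := by
  unfold segmentOf
  omega

/-- Coarsening: a segment for `B * q` lies in the segment for `B` obtained by dividing its
index by `q`. -/
theorem segmentOf_mul_div (B : ℕ) {q : ℕ} (hq : 0 < q) (x : ℝ) :
    segmentOf (B * q) x / q = segmentOf B x := by
  unfold segmentOf
  have h1 : ⌊x * (B * q : ℕ)⌋₊ / q = ⌊x * B⌋₊ := by
    rw [← Nat.floor_div_natCast]
    congr 1
    push_cast
    field_simp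
  have h2 : (B * q - 1) / q = B - 1 := by
    rcases Nat.eq_zero_or_pos B with rfl | hB
    · simp
    · obtain ⟨b, rfl⟩ : ∃ b, B = b + 1 := ⟨B - 1, by omega⟩
      rw [Nat.div_eq_iff hq]
      simp only [Nat.add_sub_cancel, Nat.add_mul, Nat.one_mul]
      omega
  have hmono : Monotone fun a : ℕ => a / q := fun a b h => Nat.div_le_div_right h
  rw [← h1, ← h2]
  exact hmono.map_min

/-- The number of items of the segment `i` for `B` that arrive at the times `s ≤ r < t`. -/
noncomputable def segCount {n : ℕ} (x : Fin n → ℝ) (s t B i : ℕ) : ℕ :=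
  (Finset.univ.filter fun r : Fin n =>
    s ≤ (r : ℕ) ∧ (r : ℕ) < t ∧ segmentOf B (x r) = i).card

theorem segCount_eq_sum {n : ℕ} (x : Fin n → ℝ) (s t B i : ℕ) :
    segCount x s t B i = ∑ r ∈ Finset.univ.filter (fun r : Fin n => s ≤ (r : ℕ) ∧ (r : ℕ) < t),
      if segmentOf B (x r) = i then 1 else 0 := by
  rw [← Finset.card_filter, Finset.filter_filter, segCount]
  simp only [and_assoc]

theorem segCount_self {n : ℕ} (x : Fin n → ℝ) (s B i : ℕ) : segCount x s s B i = 0 := by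
  unfold segCount
  rw [Finset.card_eq_zero, Finset.filter_eq_empty_iff]
  intro r _ h
  omega

theorem segCount_add {n : ℕ} (x : Fin n → ℝ) {s t u : ℕ} (hst : s ≤ t) (htu : t ≤ u) (B i : ℕ) :
    segCount x s t B i + segCount x t u B i = segCount x s u B i := by
  unfold segCount
  rw [← Finset.card_union_of_disjoint]
  · congr 1
    ext r
    simp only [Finset.mem_union, Finset.mem_filter, Finset.mem_univ, true_and]
    constructor
    · rintro (⟨h1, h2, h3⟩ | ⟨h1, h2, h3⟩)
      · exact ⟨h1, by omega, h3⟩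
      · exact ⟨by omega, h2, h3⟩
    · rintro ⟨h1, h2, h3⟩
      rcases lt_or_ge (r : ℕ) t with h | h
      · exact Or.inl ⟨h1, h, h3⟩
      · exact Or.inr ⟨h, h2, h3⟩
  · rw [Finset.disjoint_filter]
    intro r _ h1 h2
    omega

theorem segCount_single {n : ℕ} (x : Fin n → ℝ) {t : ℕ} (ht : t < n) (B i : ℕ) :
    segCount x t (t + 1) B i = if segmentOf B (x ⟨t, ht⟩) = i then 1 else 0 := by
  have : (Finset.univ.filter fun r : Fin n => t ≤ (r : ℕ) ∧ (r : ℕ) < t + 1) = {⟨t, ht⟩} := by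
    ext r
    simp [Fin.ext_iff]
    omega
  rw [segCount_eq_sum, this, Finset.sum_singleton]

theorem segCount_succ {n : ℕ} (x : Fin n → ℝ) {s t : ℕ} (hst : s ≤ t) (ht : t < n) (B i : ℕ) :
    segCount x s (t + 1) B i
      = segCount x s t B i + if segmentOf B (x ⟨t, ht⟩) = i then 1 else 0 := by
  rw [← segCount_add x hst (Nat.le_succ t), segCount_single x ht]

theorem sum_segCount {n : ℕ} (x : Fin n → ℝ) {s t B : ℕ} (hB : 0 < B) (ht : t ≤ n) :
    ∑ i ∈ Finset.range B, segCount x s t B i = t - s := by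
  simp only [segCount_eq_sum]
  rw [Finset.sum_comm]
  have h1 : ∀ r : Fin n, ∑ i ∈ Finset.range B, (if segmentOf B (x r) = i then 1 else 0) = 1 := by
    intro r
    rw [Finset.sum_ite_eq, if_pos (Finset.mem_range.2 (segmentOf_lt hB _))]
  simp only [h1, Finset.sum_const, smul_eq_mul, mul_one]
  rw [← Nat.card_Ico, ← Finset.card_map Fin.valEmbedding]
  congr 1
  ext a
  simp only [Finset.mem_map, Finset.mem_filter, Finset.mem_univ, true_and, Fin.valEmbedding_apply,
    Finset.mem_Ico]
  exact ⟨by rintro ⟨r, h, rfl⟩; exact h, fun h => ⟨⟨a, by omega⟩, h, rfl⟩⟩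

/-- Summing over the `q` indices with the same quotient picks out that quotient. -/
theorem sum_range_ite_div {q : ℕ} (hq : 0 < q) (a i c : ℕ) :
    ∑ k ∈ Finset.range q, (if a = i * q + k then c else 0) = if a / q = i then c else 0 := by
  by_cases h : a / q = i
  · rw [if_pos h, Finset.sum_eq_single (a % q)]
    · rw [if_pos]
      rw [← h, mul_comm]
      exact (Nat.div_add_mod a q).symm
    · intro b hbm hb
      rw [Finset.mem_range] at hbm
      rw [if_neg]
      rintro rfl
      apply hb
      rw [mul_comm, Nat.mul_add_mod, Nat.mod_eq_of_lt hbm]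
    · intro hn
      exact absurd (Finset.mem_range.2 (Nat.mod_lt _ hq)) hn
  · rw [if_neg h]
    refine Finset.sum_eq_zero fun k hk => if_neg ?_
    rintro rfl
    apply h
    rw [Finset.mem_range] at hk
    rw [mul_comm, Nat.mul_add_div hq, Nat.div_eq_of_lt hk, add_zero]

theorem sum_segCount_mul {n : ℕ} (x : Fin n → ℝ) (s t B : ℕ) {q : ℕ} (hq : 0 < q) (i : ℕ) :
    ∑ k ∈ Finset.range q, segCount x s t (B * q) (i * q + k) = segCount x s t B i := by
  simp only [segCount_eq_sum]
  rw [Finset.sum_comm]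
  refine Finset.sum_congr rfl fun r _ => ?_
  rw [sum_range_ite_div hq, segmentOf_mul_div B hq]

theorem segmentOf_bounds {B : ℕ} (hB : 0 < B) {x : ℝ} (hx : x ∈ Set.Icc (0 : ℝ) 1) :
    (segmentOf B x : ℝ) / B ≤ x ∧ x ≤ ((segmentOf B x : ℝ) + 1) / B := by
  have hB' : (0 : ℝ) < B := by exact_mod_cast hB
  have hx0 : 0 ≤ x * B := mul_nonneg hx.1 hB'.le
  have h1 : (⌊x * B⌋₊ : ℝ) ≤ x * B := Nat.floor_le hx0
  have h2 : x * B < ⌊x * B⌋₊ + 1 := Nat.lt_floor_add_one _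
  have h3 : x * B ≤ B := by nlinarith [hx.2]
  rw [div_le_iff₀ hB', le_div_iff₀ hB']
  unfold segmentOf
  rcases le_total ⌊x * B⌋₊ (B - 1) with h | h
  · rw [min_eq_left h]
    exact ⟨h1, h2.le⟩
  · rw [min_eq_right h]
    have h4 : ((B - 1 : ℕ) : ℝ) ≤ ⌊x * B⌋₊ := by exact_mod_cast h
    refine ⟨h4.trans h1, ?_⟩
    rw [Nat.cast_sub (by omega)]
    simpa using h3


/-! ### Empty cells -/

section EmptyCells

variable {n : ℕ} {cells : Fin n → Option ℝ}

theorem emptyCount_update {k : Fin n} (hk : cells k = none) (v : ℝ) (a l : ℕ) :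
    emptyCount cells a l = emptyCount (Function.update cells k (some v)) a l
      + if a ≤ (k : ℕ) ∧ (k : ℕ) < a + l then 1 else 0 := by
  unfold emptyCount
  split_ifs with h
  · rw [← Finset.card_insert_of_notMem (a := k)]
    · congr 1
      ext r
      by_cases hr : r = k
      · subst hr
        simp [hk, h]
      · simp [hr]
    · simp
  · rw [add_zero]
    congr 1
    ext r
    by_cases hr : r = k
    · subst hr
      simp only [Finset.mem_filter, Finset.mem_univ, true_and]
      constructor <;> rintro ⟨h1, h2, -⟩ <;> exact absurd ⟨h1, h2⟩ h
    · simp [hr]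

theorem emptyCount_add (cells : Fin n → Option ℝ) (a l m : ℕ) :
    emptyCount cells a (l + m) = emptyCount cells a l + emptyCount cells (a + l) m := by
  unfold emptyCount
  rw [← Finset.card_union_of_disjoint]
  · congr 1
    ext r
    simp only [Finset.mem_union, Finset.mem_filter, Finset.mem_univ, true_and]
    constructor
    · rintro ⟨h1, h2, h3⟩
      rcases lt_or_ge (r : ℕ) (a + l) with h | h
      · exact Or.inl ⟨h1, h, h3⟩
      · exact Or.inr ⟨h, by omega, h3⟩
    · rintro (⟨h1, h2, h3⟩ | ⟨h1, h2, h3⟩)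
      · exact ⟨h1, by omega, h3⟩
      · exact ⟨by omega, by omega, h3⟩
  · rw [Finset.disjoint_filter]
    intro r _ h1 h2
    omega

theorem emptyCount_of_empty {a l : ℕ} (hal : a + l ≤ n)
    (h : ∀ k : Fin n, a ≤ (k : ℕ) → (k : ℕ) < a + l → cells k = none) :
    emptyCount cells a l = l := by
  unfold emptyCount
  conv_rhs => rw [show l = a + l - a by omega, ← Nat.card_Ico]
  rw [← Finset.card_map Fin.valEmbedding]
  congr 1
  ext m
  simp only [Finset.mem_map, Finset.mem_filter, Finset.mem_univ, true_and, Fin.valEmbedding_apply,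
    Finset.mem_Ico]
  constructor
  · rintro ⟨r, hr, rfl⟩
    exact ⟨hr.1, hr.2.1⟩
  · intro hm
    exact ⟨⟨m, by omega⟩, ⟨hm.1, hm.2, by simp [h ⟨m, by omega⟩ hm.1 hm.2]⟩, rfl⟩

theorem emptyCount_pos_of {k : Fin n} (hk : cells k = none) {a l : ℕ} (h1 : a ≤ (k : ℕ))
    (h2 : (k : ℕ) < a + l) : 0 < emptyCount cells a l :=
  Finset.card_pos.2 ⟨k, by simp [hk, h1, h2]⟩

theorem firstEmpty_eq_none {a l : ℕ} :
    firstEmpty cells a l = none ↔ emptyCount cells a l = 0 := by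
  unfold firstEmpty emptyCount
  rw [List.find?_eq_none, Finset.card_eq_zero, Finset.filter_eq_empty_iff]
  simp [and_assoc]

theorem mem_of_firstEmpty {a l : ℕ} {k : Fin n} (h : firstEmpty cells a l = some k) :
    a ≤ (k : ℕ) ∧ (k : ℕ) < a + l := by
  have := List.find?_some h
  simp at this
  exact this.1

end EmptyCells

/-! ### Lists of buffers -/

theorem Buffer.belongsTo_iff {b : Buffer} {B q i : ℕ} (hB : 0 < B) (hq : 0 < q)
    (h : b.numSeg = B * q) : b.BelongsTo B i ↔ b.seg / q = i := by
  unfold Buffer.BelongsTo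
  rw [h, Nat.div_eq_iff hq]
  have e1 : i * (B * q) ≤ b.seg * B ↔ i * q ≤ b.seg := by
    rw [show i * (B * q) = (i * q) * B by ring]
    exact Nat.mul_le_mul_right_iff hB
  have e2 : (b.seg + 1) * B ≤ (i + 1) * (B * q) ↔ b.seg + 1 ≤ (i + 1) * q := by
    rw [show (i + 1) * (B * q) = ((i + 1) * q) * B by ring]
    exact Nat.mul_le_mul_right_iff hB
  rw [e1, e2, Nat.add_mul, Nat.one_mul]
  omega

/-- A buffer that accepts `x` belongs to the current segment of `x`, and to no other. -/
theorem Buffer.Accepts.belongsTo_iff {b : Buffer} {x : ℝ} (hx : b.Accepts x) {B i : ℕ} (hB : 0 < B)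
    (h : B ∣ b.numSeg) (hpos : 0 < b.numSeg) : b.BelongsTo B i ↔ segmentOf B x = i := by
  obtain ⟨q, hq⟩ := h
  have hq0 : 0 < q := by
    rcases Nat.eq_zero_or_pos q with rfl | h
    · simp at hq
      omega
    · exact h
  rw [Buffer.belongsTo_iff hB hq0 hq, ← segmentOf_mul_div B hq0 x, ← hq]
  unfold Buffer.Accepts at hx
  rw [hx]

/-- The cells of a buffer. -/
def Buffer.Covers (b : Buffer) (k : ℕ) : Prop := b.start ≤ k ∧ k < b.start + b.size

open Classical in
/-- The number of empty cells in the buffers of the list `l` that belong to the segment `i`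
for `B`. Unlike `State.capacity`, it refers to an arbitrary granularity `B`. -/
noncomputable def capAt {n : ℕ} (cells : Fin n → Option ℝ) (l : List Buffer) (B i : ℕ) : ℕ :=
  ((l.filter fun b => decide (b.BelongsTo B i)).map fun b => emptyCount cells b.start b.size).sum

theorem State.capacity_eq {n : ℕ} (st : State n) (i : ℕ) :
    st.capacity i = capAt st.cells st.buffers st.numSeg i := rfl

section Capacity

variable {n : ℕ} {cells : Fin n → Option ℝ}

@[simp]
theorem capAt_nil (cells : Fin n → Option ℝ) (B i : ℕ) : capAt cells [] B i = 0 := rfl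

open Classical in
theorem capAt_cons (cells : Fin n → Option ℝ) (b : Buffer) (l : List Buffer) (B i : ℕ) :
    capAt cells (b :: l) B i
      = (if b.BelongsTo B i then emptyCount cells b.start b.size else 0) + capAt cells l B i := by
  unfold capAt
  rw [List.filter_cons]
  split_ifs with h1 h2 h2 <;> simp_all

theorem capAt_append (cells : Fin n → Option ℝ) (l l' : List Buffer) (B i : ℕ) :
    capAt cells (l ++ l') B i = capAt cells l B i + capAt cells l' B i := by
  unfold capAt
  simp

theorem capAt_eq_zero {l : List Buffer} {B i : ℕ}
    (h : ∀ b ∈ l, b.BelongsTo B i → emptyCount cells b.start b.size = 0) :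
    capAt cells l B i = 0 := by
  unfold capAt
  rw [List.sum_eq_zero]
  intro a ha
  rw [List.mem_map] at ha
  obtain ⟨b, hb, rfl⟩ := ha
  rw [List.mem_filter] at hb
  exact h b hb.1 (by simpa using hb.2)

theorem emptyCount_le_capAt {l : List Buffer} {B i : ℕ} {b : Buffer} (hb : b ∈ l)
    (h : b.BelongsTo B i) : emptyCount cells b.start b.size ≤ capAt cells l B i := by
  classical
  unfold capAt
  refine List.single_le_sum (fun _ _ => Nat.zero_le _) _ ?_
  rw [List.mem_map]
  refine ⟨b, ?_, rfl⟩
  rw [List.mem_filter]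
  exact ⟨hb, by simpa using h⟩

/-- The capacity of a segment is the sum of the capacities of its `q` parts, if no buffer is
allocated to more than one part. -/
theorem capAt_eq_sum (cells : Fin n → Option ℝ) {B q : ℕ} (hB : 0 < B) (hq : 0 < q)
    {l : List Buffer} (hl : ∀ b ∈ l, 0 < b.numSeg ∧ B * q ∣ b.numSeg) (i : ℕ) :
    capAt cells l B i = ∑ k ∈ Finset.range q, capAt cells l (B * q) (i * q + k) := by
  classical
  induction l with
  | nil => simp
  | cons b l ih =>
    simp only [capAt_cons]
    rw [Finset.sum_add_distrib, ih fun b' hb' => hl b' (List.mem_cons_of_mem _ hb')]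
    congr 1
    obtain ⟨hpos, p, hp⟩ := hl b List.mem_cons_self
    have hp0 : 0 < p := by
      rcases Nat.eq_zero_or_pos p with rfl | h
      · simp at hp
        omega
      · exact h
    have e1 : b.BelongsTo B i ↔ b.seg / p / q = i := by
      rw [Buffer.belongsTo_iff hB (Nat.mul_pos hq hp0) (by rw [hp, mul_assoc]),
        Nat.div_div_eq_div_mul, mul_comm p q]
    have e2 : ∀ k, b.BelongsTo (B * q) (i * q + k) ↔ b.seg / p = i * q + k := fun k =>
      Buffer.belongsTo_iff (Nat.mul_pos hB hq) hp0 hp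
    simp only [e1, e2]
    rw [sum_range_ite_div hq]

theorem capAt_le_sum (cells : Fin n → Option ℝ) {B q : ℕ} (hB : 0 < B) (hq : 0 < q)
    {l : List Buffer} {i : ℕ} (hl : ∀ b ∈ l, b.BelongsTo B i → emptyCount cells b.start b.size ≠ 0 →
      0 < b.numSeg ∧ B * q ∣ b.numSeg) :
    capAt cells l B i ≤ ∑ k ∈ Finset.range q, capAt cells l (B * q) (i * q + k) := by
  classical
  induction l with
  | nil => simp
  | cons b l ih =>
    simp only [capAt_cons]
    rw [Finset.sum_add_distrib]
    refine Nat.add_le_add ?_ (ih fun b' hb' => hl b' (List.mem_cons_of_mem _ hb'))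
    by_cases h : b.BelongsTo B i ∧ emptyCount cells b.start b.size ≠ 0
    · obtain ⟨hpos, hdvd⟩ := hl b List.mem_cons_self h.1 h.2
      have := capAt_eq_sum cells hB hq (l := [b]) (by simpa using ⟨hpos, hdvd⟩) i
      simp only [capAt_cons, capAt_nil, add_zero] at this
      exact this.le
    · by_cases h' : b.BelongsTo B i
      · have : emptyCount cells b.start b.size = 0 := by
          by_contra hc
          exact h ⟨h', hc⟩
        simp [this]
      · simp [h']

/-- Every empty cell of a buffer counts for exactly one segment. -/
theorem sum_capAt (cells : Fin n → Option ℝ) {B : ℕ} (hB : 0 < B)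
    {l : List Buffer} (hl : ∀ b ∈ l, b.seg < b.numSeg ∧ B ∣ b.numSeg) :
    ∑ i ∈ Finset.range B, capAt cells l B i
      = (l.map fun b => emptyCount cells b.start b.size).sum := by
  classical
  induction l with
  | nil => simp
  | cons b l ih =>
    simp only [capAt_cons]
    rw [Finset.sum_add_distrib, ih fun b' hb' => hl b' (List.mem_cons_of_mem _ hb'), List.map_cons,
      List.sum_cons]
    congr 1
    obtain ⟨hlt, p, hp⟩ := hl b List.mem_cons_self
    have hp0 : 0 < p := by
      rcases Nat.eq_zero_or_pos p with rfl | h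
      · simp at hp
        omega
      · exact h
    simp only [Buffer.belongsTo_iff hB hp0 hp]
    rw [Finset.sum_ite_eq, if_pos]
    rw [Finset.mem_range, Nat.div_lt_iff_lt_mul hp0, ← hp]
    exact hlt

/-! ### Tilings -/

/-- The buffers of the list are adjacent subarrays that together fill the cells from `a` up
to `c`. -/
def Tiles : List Buffer → ℕ → ℕ → Prop
  | [], a, c => a = c
  | b :: l, a, c => b.start = a ∧ Tiles l (a + b.size) c

theorem tiles_append {l l' : List Buffer} {a c : ℕ} :
    Tiles (l ++ l') a c ↔ ∃ m, Tiles l a m ∧ Tiles l' m c := by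
  induction l generalizing a with
  | nil => simp [Tiles]
  | cons b l ih =>
    simp only [List.cons_append, Tiles, ih]
    constructor
    · rintro ⟨h1, m, h2, h3⟩
      exact ⟨m, ⟨h1, h2⟩, h3⟩
    · rintro ⟨m, ⟨h1, h2⟩, h3⟩
      exact ⟨h1, m, h2, h3⟩

theorem Tiles.le {l : List Buffer} {a c : ℕ} (h : Tiles l a c) : a ≤ c := by
  induction l generalizing a with
  | nil => exact le_of_eq h
  | cons b l ih => exact (Nat.le_add_right _ _).trans (ih h.2)

theorem Tiles.bounds {l : List Buffer} {a c : ℕ} (h : Tiles l a c) {b : Buffer} (hb : b ∈ l) :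
    a ≤ b.start ∧ b.start + b.size ≤ c := by
  induction l generalizing a with
  | nil => simp at hb
  | cons b' l ih =>
    rcases List.mem_cons.1 hb with rfl | hb
    · exact ⟨h.1.ge, by rw [h.1]; exact h.2.le⟩
    · have := ih h.2 hb
      omega

theorem Tiles.emptyCount_eq {l : List Buffer} {a c : ℕ} (h : Tiles l a c)
    (cells : Fin n → Option ℝ) :
    emptyCount cells a (c - a) = (l.map fun b => emptyCount cells b.start b.size).sum := by
  induction l generalizing a with
  | nil =>
    cases h
    simp [emptyCount]
    intro k h1 h2
    omega
  | cons b l ih =>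
    rw [List.map_cons, List.sum_cons, ← ih h.2, h.1, ← emptyCount_add]
    congr 1
    have := h.2.le
    omega

/-- In a tiling, a buffer that covers a cell is the only one to do so. -/
theorem Tiles.notCovers {l l' : List Buffer} {b : Buffer} {a c k : ℕ}
    (h : Tiles (l ++ b :: l') a c) (hk : b.Covers k) : ∀ b' ∈ l ++ l', ¬ b'.Covers k := by
  obtain ⟨m, h1, h2, h3⟩ := tiles_append.1 h
  unfold Buffer.Covers at *
  intro b' hb' hc
  rcases List.mem_append.1 hb' with hb' | hb'
  · have := h1.bounds hb'
    omega
  · have := h3.bounds hb'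
    omega

theorem capAt_update_of_notCovers {l : List Buffer} {k : Fin n} (hk : cells k = none) (v : ℝ)
    (h : ∀ b ∈ l, ¬ b.Covers k) (B i : ℕ) :
    capAt (Function.update cells k (some v)) l B i = capAt cells l B i := by
  unfold capAt
  congr 1
  refine List.map_congr_left fun b hb => ?_
  have := emptyCount_update hk v b.start b.size
  have h' := h b (List.mem_of_mem_filter hb)
  unfold Buffer.Covers at h'
  rw [if_neg h', add_zero] at this
  exact this.symm

open Classical in
/-- Filling a cell of a buffer lowers the capacity of exactly those segments to which the buffer
belongs. -/
theorem capAt_update {l l' : List Buffer} {b : Buffer} {a c : ℕ}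
    (h : Tiles (l ++ b :: l') a c) {k : Fin n} (hk : cells k = none) (v : ℝ) (hb : b.Covers k)
    (B i : ℕ) :
    capAt cells (l ++ b :: l') B i
      = capAt (Function.update cells k (some v)) (l ++ b :: l') B i
        + if b.BelongsTo B i then 1 else 0 := by
  have hn := h.notCovers hb
  rw [capAt_append, capAt_append, capAt_cons, capAt_cons,
    capAt_update_of_notCovers hk v (fun b' h' => hn b' (List.mem_append_left _ h')),
    capAt_update_of_notCovers hk v (fun b' h' => hn b' (List.mem_append_right _ h'))]
  have := emptyCount_update hk v b.start b.size
  unfold Buffer.Covers at hb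
  rw [if_pos hb] at this
  split_ifs <;> omega

/-! ### Allocation -/

theorem mem_allocate {a B : ℕ} {size : ℕ → ℕ} {b : Buffer} :
    b ∈ allocate a B size ↔
      ∃ i < B, b = ⟨a + ∑ k ∈ Finset.range i, size k, size i, B, i⟩ := by
  unfold allocate
  simp only [List.mem_map, List.mem_range]
  exact ⟨fun ⟨i, h, e⟩ => ⟨i, h, e.symm⟩, fun ⟨i, h, e⟩ => ⟨i, h, e.symm⟩⟩

theorem tiles_allocate (a B : ℕ) (size : ℕ → ℕ) :
    Tiles (allocate a B size) a (a + ∑ k ∈ Finset.range B, size k) := by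
  unfold allocate
  suffices h : ∀ m, Tiles ((List.range m).map fun i =>
      (⟨a + ∑ k ∈ Finset.range i, size k, size i, B, i⟩ : Buffer)) a
        (a + ∑ k ∈ Finset.range m, size k) from h B
  intro m
  induction m with
  | zero => simp [Tiles]
  | succ m ih =>
    rw [List.range_succ, List.map_append, tiles_append]
    refine ⟨_, ih, ?_⟩
    simp only [List.map_cons, List.map_nil, Tiles, true_and]
    rw [Finset.sum_range_succ, add_assoc]

theorem capAt_allocate {a B : ℕ} {size : ℕ → ℕ} (hB : 0 < B)
    (hn : a + ∑ k ∈ Finset.range B, size k ≤ n)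
    (hc : ∀ k : Fin n, a ≤ (k : ℕ) → cells k = none) {i : ℕ} (hi : i < B) :
    capAt cells (allocate a B size) B i = size i := by
  classical
  have key : ∀ j < B, emptyCount cells (a + ∑ k ∈ Finset.range j, size k) (size j) = size j := by
    intro j hj
    refine emptyCount_of_empty ?_ fun k h1 _ => hc k (by omega)
    have : ∑ k ∈ Finset.range (j + 1), size k ≤ ∑ k ∈ Finset.range B, size k :=
      Finset.sum_le_sum_of_subset (Finset.range_mono hj)
    rw [Finset.sum_range_succ] at this
    omega
  suffices h : ∀ m ≤ B, capAt cells ((List.range m).map fun i =>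
      (⟨a + ∑ k ∈ Finset.range i, size k, size i, B, i⟩ : Buffer)) B i
        = if i < m then size i else 0 by
    have := h B le_rfl
    rw [if_pos hi] at this
    exact this
  intro m hm
  induction m with
  | zero => simp
  | succ m ih =>
    rw [List.range_succ, List.map_append, capAt_append, ih (by omega), List.map_cons, List.map_nil,
      capAt_cons, capAt_nil, add_zero, key m (by omega),
      Buffer.belongsTo_iff hB Nat.one_pos (mul_one B).symm, Nat.div_one]
    dsimp only
    rcases lt_trichotomy i m with h | h | h
    · rw [if_pos h, if_neg (by omega), if_pos (by omega), add_zero]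
    · subst h
      simp
    · rw [if_neg (by omega), if_neg (by omega), if_neg (by omega)]

/-- A buffer of a segment does not belong to any finer segment. -/
theorem capAt_allocate_fine (cells : Fin n → Option ℝ) (a : ℕ) {B q : ℕ} (size : ℕ → ℕ) (hB : 0 < B)
    (hq : 2 ≤ q) (i : ℕ) : capAt cells (allocate a B size) (B * q) i = 0 := by
  refine capAt_eq_zero fun b hb h => ?_
  obtain ⟨j, -, rfl⟩ := mem_allocate.1 hb
  unfold Buffer.BelongsTo at h
  dsimp only at h
  obtain ⟨h1, h2⟩ := h
  have h3 : i ≤ j * q := by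
    refine Nat.le_of_mul_le_mul_right ?_ hB
    calc i * B ≤ _ := h1
      _ = _ := by ring
  have h4 : (j + 1) * q ≤ i + 1 := by
    refine Nat.le_of_mul_le_mul_right ?_ hB
    calc (j + 1) * q * B = _ := by ring
      _ ≤ _ := h2
  rw [Nat.add_mul] at h4
  omega

end Capacity

/-! ### The buffer that receives an item -/

open Classical in
/-- The search for the oldest non-full buffer that accepts `x`. -/
theorem exists_findSome {n : ℕ} {cells : Fin n → Option ℝ} {l : List Buffer} {x : ℝ}
    (h : ∃ b ∈ l, b.Accepts x ∧ emptyCount cells b.start b.size ≠ 0) :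
    ∃ k l₁ b l₂, l = l₁ ++ b :: l₂ ∧ b.Accepts x ∧ b.Covers k ∧ cells k = none ∧
      (l.findSome? fun b =>
        if b.Accepts x then firstEmpty cells b.start b.size else none) = some k ∧
      ∀ b' ∈ l₁, b'.Accepts x → emptyCount cells b'.start b'.size = 0 := by
  have hsome : (l.findSome? fun b =>
      if b.Accepts x then firstEmpty cells b.start b.size else none) ≠ none := by
    rw [Ne, List.findSome?_eq_none_iff]
    intro hn
    obtain ⟨b, hb, hx, he⟩ := h
    have := hn b hb
    rw [if_pos hx, firstEmpty_eq_none] at this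
    exact he this
  obtain ⟨k, hk⟩ := Option.ne_none_iff_exists'.1 hsome
  obtain ⟨l₁, b, l₂, hl, hb, hn⟩ := List.findSome?_eq_some_iff.1 hk
  split_ifs at hb with hx
  refine ⟨k, l₁, b, l₂, hl, hx, mem_of_firstEmpty hb, firstEmpty_isNone hb, hk, ?_⟩
  intro b' hb' hx'
  have := hn b' hb'
  rwa [if_pos hx', firstEmpty_eq_none] at this

open Classical in
theorem findSome_eq_none {n : ℕ} {cells : Fin n → Option ℝ} {l : List Buffer} {x : ℝ}
    (h : ∀ b ∈ l, b.Accepts x → emptyCount cells b.start b.size = 0) :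
    (l.findSome? fun b =>
      if b.Accepts x then firstEmpty cells b.start b.size else none) = none := by
  rw [List.findSome?_eq_none_iff]
  intro b hb
  split_ifs with hx
  · exact firstEmpty_eq_none.2 (h b hb hx)
  · rfl


/-! ### Estimates for the predictions -/

section Numeric

theorem rpow_two_thirds_le_self {μ : ℝ} (h : 1 ≤ μ) : μ ^ (2 / 3 : ℝ) ≤ μ := by
  conv_rhs => rw [← Real.rpow_one μ]
  exact Real.rpow_le_rpow_of_exponent_le h (by norm_num)

theorem rpow_two_thirds_cube {a : ℝ} (ha : 0 ≤ a) : (a ^ 3) ^ (2 / 3 : ℝ) = a ^ 2 := by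
  rw [← Real.rpow_natCast a 3, ← Real.rpow_mul ha, ← Real.rpow_natCast a 2]
  norm_num

theorem rpow_two_thirds_le_tenth {μ : ℝ} (h : 1000 ≤ μ) : μ ^ (2 / 3 : ℝ) ≤ μ / 10 := by
  have h0 : 0 ≤ μ := by linarith
  obtain ⟨a, ha, rfl⟩ : ∃ a : ℝ, 0 ≤ a ∧ a ^ 3 = μ := by
    refine ⟨μ ^ (1 / 3 : ℝ), Real.rpow_nonneg h0 _, ?_⟩
    rw [← Real.rpow_natCast, ← Real.rpow_mul h0]
    norm_num
  rw [rpow_two_thirds_cube ha]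
  have h10 : 10 ≤ a := by
    by_contra hc
    push Not at hc
    have : a ^ 3 < 10 ^ 3 := pow_lt_pow_left₀ hc ha (by norm_num)
    linarith
  nlinarith [sq_nonneg a]

theorem le_rpow_two_thirds {a μ : ℝ} (ha : 0 ≤ a) (h : a ^ 3 ≤ μ) : a ^ 2 ≤ μ ^ (2 / 3 : ℝ) := by
  rw [← rpow_two_thirds_cube ha]
  exact Real.rpow_le_rpow (by positivity) h (by norm_num)

theorem rpow_two_thirds_le {a μ : ℝ} (ha : 0 ≤ a) (hμ : 0 ≤ μ) (h : μ ≤ a ^ 3) :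
    μ ^ (2 / 3 : ℝ) ≤ a ^ 2 := by
  rw [← rpow_two_thirds_cube ha]
  exact Real.rpow_le_rpow hμ h (by norm_num)

theorem le_prediction (N B : ℕ) :
    (N : ℝ) / B - 1 / 2 * ((N : ℝ) / B) ^ (2 / 3 : ℝ) ≤ prediction N B :=
  Nat.le_ceil _

theorem prediction_le {N B : ℕ} (h : 1 ≤ (N : ℝ) / B) :
    (prediction N B : ℝ) ≤ (N : ℝ) / B - 1 / 2 * ((N : ℝ) / B) ^ (2 / 3 : ℝ) + 1 := by
  refine (Nat.ceil_lt_add_one ?_).le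
  have := rpow_two_thirds_le_self h
  linarith

theorem prediction_le_div {N B : ℕ} (h : 1000000 ≤ (N : ℝ) / B) :
    (prediction N B : ℝ) ≤ (N : ℝ) / B := by
  have h1 := prediction_le (N := N) (B := B) (by linarith)
  have h2 := le_rpow_two_thirds (a := 100) (by norm_num) (μ := (N : ℝ) / B) (by linarith)
  linarith

theorem pos_of_div_large {N B : ℕ} (h : 1000000 ≤ (N : ℝ) / B) : 0 < B := by
  rcases Nat.eq_zero_or_pos B with rfl | h'
  · norm_num at h
  · exact h'

theorem mul_prediction_le {N B : ℕ} (h : 1000000 ≤ (N : ℝ) / B) : B * prediction N B ≤ N := by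
  have hB : (0 : ℝ) < B := by exact_mod_cast pos_of_div_large h
  have := prediction_le_div h
  rw [le_div_iff₀ hB] at this
  have h' : (B : ℝ) * prediction N B ≤ N := by linarith
  exact_mod_cast h'

theorem prediction_pos {N B : ℕ} (h : 1 ≤ (N : ℝ) / B) : 0 < prediction N B := by
  have h1 := le_prediction N B
  have h2 := rpow_two_thirds_le_self h
  have : (0 : ℝ) < prediction N B := by linarith
  exact_mod_cast this

/-- If some segment received `m(N, B)` items among the first `T` of `N` items, few items are left:
the prediction is short of the average by only half of `(N / B) ^ (2 / 3)`. -/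
theorem div_le_of_prediction_le {N T B c : ℕ} (hT : T ≤ N)
    (hc : |(c : ℝ) - (T : ℝ) / B| ≤ ((N : ℝ) / B) ^ (2 / 3 : ℝ) / 20) (hm : prediction N B ≤ c) :
    ((N - T : ℕ) : ℝ) / B ≤ 11 / 20 * ((N : ℝ) / B) ^ (2 / 3 : ℝ) := by
  have h1 := le_prediction N B
  have h2 : (prediction N B : ℝ) ≤ c := by exact_mod_cast hm
  have h3 := (abs_le.1 hc).2
  rw [Nat.cast_sub hT, sub_div]
  linarith

/-- If no segment received more than `m(N, B)` items among the first `T` of `N` items, many items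
are left. -/
theorem le_div_of_le_mul_prediction {N T B : ℕ} (hM : 1000000 ≤ (N : ℝ) / B) (hT : T ≤ N)
    (h : T ≤ B * prediction N B) :
    ((N : ℝ) / B) ^ (2 / 3 : ℝ) / 4 ≤ ((N - T : ℕ) : ℝ) / B := by
  have hB : (0 : ℝ) < B := by exact_mod_cast pos_of_div_large hM
  have h1 := prediction_le (N := N) (B := B) (by linarith)
  have h2 := le_rpow_two_thirds (a := 100) (by norm_num) (μ := (N : ℝ) / B) (by linarith)
  have h3 : (T : ℝ) / B ≤ prediction N B := by
    rw [div_le_iff₀ hB]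
    have : (T : ℝ) ≤ B * prediction N B := by exact_mod_cast h
    linarith
  rw [Nat.cast_sub hT, sub_div]
  linarith

/-- The remaining capacity of a segment at the end of a phase is below the next prediction, so that
the regular buffers have positive sizes. -/
theorem prediction_sub_lt {N T B c : ℕ} (hT : T ≤ N)
    (hc : |(c : ℝ) - (T : ℝ) / B| ≤ ((N : ℝ) / B) ^ (2 / 3 : ℝ) / 20)
    (hN : 1000000 ≤ ((N - T : ℕ) : ℝ) / B)
    (h : ((N - T : ℕ) : ℝ) / B ≤ 11 / 20 * ((N : ℝ) / B) ^ (2 / 3 : ℝ)) :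
    prediction N B - c < prediction (N - T) B := by
  have hpos : 0 < prediction (N - T) B := prediction_pos (by linarith)
  have hB := pos_of_div_large hN
  have hB' : (0 : ℝ) < B := by exact_mod_cast hB
  suffices (prediction N B : ℝ) < c + prediction (N - T) B by
    have : prediction N B < c + prediction (N - T) B := by exact_mod_cast this
    omega
  have hM : 1 ≤ (N : ℝ) / B := by
    have : ((N - T : ℕ) : ℝ) / B ≤ (N : ℝ) / B := by
      gcongr
      exact Nat.sub_le _ _
    linarith
  have h1 := prediction_le hM
  have h2 := le_prediction (N - T) B
  have h3 := (abs_le.1 hc).1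
  have h4 : (N : ℝ) / B - T / B = ((N - T : ℕ) : ℝ) / B := by
    rw [Nat.cast_sub hT, sub_div]
  have h5 := rpow_two_thirds_le_tenth (μ := ((N - T : ℕ) : ℝ) / B) (by linarith)
  linarith

/-- The total size of the dampening buffer of `K` merged segments. -/
theorem dampening_size {N B K : ℕ} (hK : 1000 ≤ K) (hμ : 1000000 ≤ (N : ℝ) / (B * K : ℕ)) :
    (K : ℝ) * (prediction N (B * K) + 2 / 5 * ((N : ℝ) / (B * K : ℕ)) ^ (2 / 3 : ℝ))
      ≤ prediction N B := by
  have hBK := pos_of_div_large hμ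
  have hK' : (1000 : ℝ) ≤ K := by exact_mod_cast hK
  have h1 := le_prediction N B
  have h2 := prediction_le (N := N) (B := B * K) (by linarith)
  have h3 := le_rpow_two_thirds (a := 100) (by norm_num) (μ := (N : ℝ) / (B * K : ℕ)) (by linarith)
  have h4 := rpow_two_thirds_le_tenth hK'
  set μ : ℝ := (N : ℝ) / (B * K : ℕ) with hμdef
  have h5 : (N : ℝ) / B = K * μ := by
    rw [hμdef]
    push_cast
    have hB0 : (B : ℝ) ≠ 0 := by
      have := Nat.pos_of_mul_pos_right hBK
      positivity
    have hK0 : (K : ℝ) ≠ 0 := by linarith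
    field_simp
  rw [h5, Real.mul_rpow (by linarith) (by linarith)] at h1
  refine le_trans ?_ h1
  have h6 : (K : ℝ) ^ (2 / 3 : ℝ) * μ ^ (2 / 3 : ℝ) ≤ K / 10 * μ ^ (2 / 3 : ℝ) := by gcongr
  nlinarith

/-- If one segment received far more items than predicted, all of them received at least as many
as predicted. -/
theorem prediction_le_of_large {N T B c c' : ℕ}
    (hc : |(c : ℝ) - (T : ℝ) / B| ≤ ((N : ℝ) / B) ^ (2 / 3 : ℝ) / 20)
    (hc' : |(c' : ℝ) - (T : ℝ) / B| ≤ ((N : ℝ) / B) ^ (2 / 3 : ℝ) / 20)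
    (h : (prediction N B : ℝ) + 2 / 5 * ((N : ℝ) / B) ^ (2 / 3 : ℝ) ≤ c) :
    prediction N B ≤ c' := by
  have h1 := (abs_le.1 hc).2
  have h2 := (abs_le.1 hc').1
  have h3 : 0 ≤ ((N : ℝ) / B) ^ (2 / 3 : ℝ) := by positivity
  have : (prediction N B : ℝ) ≤ c' := by linarith
  exact_mod_cast this

/-- All segments receive at least as many items as predicted, once all items have arrived. -/
theorem prediction_le_of_all {N B c : ℕ} (hM : 1000000 ≤ (N : ℝ) / B)
    (hc : |(c : ℝ) - (N : ℝ) / B| ≤ ((N : ℝ) / B) ^ (2 / 3 : ℝ) / 20) : prediction N B ≤ c := by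
  have h1 := prediction_le (N := N) (B := B) (by linarith)
  have h2 := le_rpow_two_thirds (a := 100) (by norm_num) (μ := (N : ℝ) / B) (by linarith)
  have h3 := (abs_le.1 hc).1
  have : (prediction N B : ℝ) ≤ c := by linarith
  exact_mod_cast this

/-- If the pool that is left has at least `B * K` cells, there are at least `K` items per segment
to come. -/
theorem le_div_of_pool {N B K : ℕ} (hB : 0 < B)
    (h : B * K + B * prediction N B ≤ N) : (K : ℝ) ≤ (N : ℝ) / B := by
  rw [le_div_iff₀ (by exact_mod_cast hB)]
  have : ((B * K : ℕ) : ℝ) ≤ N := by exact_mod_cast (Nat.le_add_right _ _).trans h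
  push_cast at this
  linarith

theorem cube_mul_le {N N' B K : ℕ} (hB : 0 < B) (hK : (K : ℝ) ≤ (N : ℝ) / B)
    (h : (N' : ℝ) / B ≤ ((N : ℝ) / B) ^ (2 / 3 : ℝ)) : N' ^ 3 * K ≤ N ^ 3 := by
  have hB' : (0 : ℝ) < B := by exact_mod_cast hB
  have hM : (0 : ℝ) ≤ (N : ℝ) / B := by positivity
  have h3 : ((N' : ℝ) / B) ^ 3 ≤ ((N : ℝ) / B) ^ 2 := by
    calc ((N' : ℝ) / B) ^ 3 ≤ (((N : ℝ) / B) ^ (2 / 3 : ℝ)) ^ 3 := by gcongr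
      _ = ((N : ℝ) / B) ^ 2 := by
        rw [← Real.rpow_natCast, ← Real.rpow_mul hM, ← Real.rpow_natCast]
        norm_num
  have h4 : ((N' : ℝ) / B) ^ 3 * K ≤ ((N : ℝ) / B) ^ 3 := by
    calc ((N' : ℝ) / B) ^ 3 * K ≤ ((N : ℝ) / B) ^ 2 * ((N : ℝ) / B) := by gcongr
      _ = _ := by ring
  rw [div_pow, div_pow, div_mul_eq_mul_div, div_le_div_iff_of_pos_right (by positivity)] at h4
  exact_mod_cast h4

end Numeric


/-! ### The invariant -/

/-- A list of buffers that arose from `c` successive allocations, each of one buffer with at least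
one and at most `S` cells for every segment; the buffers fill the cells before `a`. -/
inductive Batches (S : ℕ) : List Buffer → ℕ → ℕ → Prop
  | nil : Batches S [] 0 0
  | append {l : List Buffer} {a c : ℕ} (B : ℕ) (size : ℕ → ℕ) : Batches S l a c → 0 < B →
      (∀ i < B, 0 < size i ∧ size i ≤ S) →
      Batches S (l ++ allocate a B size) (a + ∑ i ∈ Finset.range B, size i) (c + 1)

theorem Batches.tiles {S : ℕ} {l : List Buffer} {a c : ℕ} (h : Batches S l a c) : Tiles l 0 a := by
  induction h with
  | nil => rfl
  | append B size _ _ _ ih => exact tiles_append.2 ⟨_, ih, tiles_allocate _ _ _⟩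

theorem Batches.size_le {S : ℕ} {l : List Buffer} {a c : ℕ} (h : Batches S l a c) :
    ∀ b ∈ l, b.size ≤ S := by
  induction h with
  | nil => simp
  | append B size _ _ hs ih =>
    intro b hb
    rcases List.mem_append.1 hb with hb | hb
    · exact ih b hb
    · obtain ⟨i, hi, rfl⟩ := mem_allocate.1 hb
      exact (hs i hi).2

/-- The streams on which the algorithm succeeds: all items lie in `[0, 1]`, and from any time `s`
on every segment receives roughly its share of the items in each period, as long as the segments
are so coarse that `(n - s) / B` is at least `K ^ (2 / 3) / 4`. -/
structure Good {n : ℕ} (x : Fin n → ℝ) : Prop where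
  mem : ∀ r, x r ∈ Set.Icc (0 : ℝ) 1
  count : ∀ B i s t : ℕ, i < B → s ≤ t → t ≤ n →
    (mergeParam n : ℝ) ^ (2 / 3 : ℝ) / 4 ≤ ((n - s : ℕ) : ℝ) / B →
    |(segCount x s t B i : ℝ) - ((t - s : ℕ) : ℝ) / B|
      ≤ (((n - s : ℕ) : ℝ) / B) ^ (2 / 3 : ℝ) / 20

/-- The invariant of the buffers, for a phase that began at time `s` with `B` segments, at time `t`.
The number `F` is the granularity of the regular buffers of the phase, so `F = B`, unless the phase
began with a merge: then `F = B * K`. Except for those of granularity `F` or `B` all buffers are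
full. The remaining capacity of each segment, for `F` and for `B`, is the prediction minus the
number of items that have arrived, truncated at `0`. Here `p` is the first cell of the
pool and `ph` is the index of the phase; the field `cube` says that on average each phase divides
the number of future items by at least `K ^ (1 / 3)`, which bounds the number of phases. -/
structure Core {n : ℕ} (x : Fin n → ℝ) (cells : Fin n → Option ℝ) (l : List Buffer)
    (p B ph s t F : ℕ) : Prop where
  hst : s ≤ t
  htn : t ≤ n
  hB : 0 < B
  hpow : ∃ a, B = mergeParam n ^ a
  hF : F = B ∨ F = B * mergeParam n
  seg_lt : ∀ b ∈ l, b.seg < b.numSeg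
  dvd : ∀ b ∈ l, B ∣ b.numSeg
  dvd_fine : ∀ b ∈ l, b.numSeg ≠ B → F ∣ b.numSeg
  full : ∀ b ∈ l, emptyCount cells b.start b.size ≠ 0 → b.numSeg = F ∨ b.numSeg = B
  sorted : l.Pairwise fun b b' => b'.numSeg ≤ b.numSeg
  empties : emptyCount cells 0 n = n - t
  accepts : ∀ b ∈ l, ∀ (k : Fin n) (v : ℝ), b.Covers k → cells k = some v → b.Accepts v
  tiles : Tiles l 0 p
  hp : p ≤ n
  capF : ∀ i < F, capAt cells l F i = prediction (n - s) F - segCount x s t F i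
  capB : ∀ i < B, capAt cells l B i = prediction (n - s) B - segCount x s t B i
  hph : 1 ≤ ph
  cube : (n - s) ^ 3 * mergeParam n ^ ph ≤ n ^ 3 * mergeParam n
  low : (mergeParam n : ℝ) ^ (2 / 3 : ℝ) / 4 ≤ ((n - s : ℕ) : ℝ) / F
  high : ((n - s : ℕ) : ℝ) / B ≤ (mergeParam n : ℝ) ^ 3

/-- The invariant of the states of the algorithm; see `Core`. -/
structure Inv {n : ℕ} (x : Fin n → ℝ) (t : ℕ) (st : State n) (s F : ℕ) : Prop where
  core : Core x st.cells st.buffers st.poolStart st.numSeg st.phase s t F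
  failed : st.failed = false
  items : st.phaseItems = n - s
  batches : ∃ c ≤ 2 * st.phase, Batches (mergeParam n ^ 3) st.buffers st.poolStart c
  running : st.last = false → (mergeParam n : ℝ) ≤ ((n - s : ℕ) : ℝ) / st.numSeg ∧
    (∀ k : Fin n, st.poolStart ≤ k → st.cells k = none) ∧
    ∀ i < st.numSeg, segCount x s t st.numSeg i ≤ prediction (n - s) st.numSeg
  final : st.last = true → F = st.numSeg ∧ n - st.poolStart ≤ mergeParam n ^ 2

section Step

variable {n : ℕ} {x : Fin n → ℝ} {cells : Fin n → Option ℝ} {l : List Buffer}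
  {p B ph s t F : ℕ}

theorem large_of_low (hK : 10 ^ 12 ≤ mergeParam n) {μ : ℝ}
    (h : (mergeParam n : ℝ) ^ (2 / 3 : ℝ) / 4 ≤ μ) : 1000000 ≤ μ := by
  have := le_rpow_two_thirds (a := 10 ^ 4) (μ := mergeParam n) (by norm_num)
    (by
      have : (10 ^ 12 : ℝ) ≤ mergeParam n := by exact_mod_cast hK
      norm_num at this ⊢
      exact this)
  linarith

namespace Core

theorem numSeg_pos (h : Core x cells l p B ph s t F) {b : Buffer} (hb : b ∈ l) : 0 < b.numSeg :=
  (Nat.zero_le _).trans_lt (h.seg_lt b hb)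

theorem dvdF (h : Core x cells l p B ph s t F) : B ∣ F := by
  rcases h.hF with hF | hF
  · exact hF ▸ dvd_rfl
  · exact hF ▸ Dvd.intro _ rfl

theorem F_pos (h : Core x cells l p B ph s t F) (hK : 10 ^ 12 ≤ mergeParam n) : 0 < F :=
  pos_of_div_large (large_of_low hK h.low)

theorem B_le_F (h : Core x cells l p B ph s t F) (hK : 10 ^ 12 ≤ mergeParam n) : B ≤ F :=
  Nat.le_of_dvd (h.F_pos hK) h.dvdF

theorem lowB (h : Core x cells l p B ph s t F) (hK : 10 ^ 12 ≤ mergeParam n) :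
    (mergeParam n : ℝ) ^ (2 / 3 : ℝ) / 4 ≤ ((n - s : ℕ) : ℝ) / B := by
  refine h.low.trans ?_
  have h1 : (0 : ℝ) < B := by exact_mod_cast h.hB
  have h2 : (B : ℝ) ≤ F := by exact_mod_cast h.B_le_F hK
  gcongr

/-- A non-full buffer that belongs to a segment for `F` has this segment as its initial segment. -/
theorem numSeg_eq_of_belongsTo (h : Core x cells l p B ph s t F) (hK : 10 ^ 12 ≤ mergeParam n)
    {b : Buffer} (hb : b ∈ l) (he : emptyCount cells b.start b.size ≠ 0) {i : ℕ}
    (hi : b.BelongsTo F i) : b.numSeg = F ∧ b.seg = i := by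
  have hF := h.F_pos hK
  have key : b.numSeg = F := by
    rcases h.full b hb he with h1 | h1
    · exact h1
    rcases h.hF with h2 | h2
    · exact h1.trans h2.symm
    exfalso
    unfold Buffer.BelongsTo at hi
    rw [h1, h2] at hi
    obtain ⟨h3, h4⟩ := hi
    have h5 : i ≤ b.seg * mergeParam n := by
      refine Nat.le_of_mul_le_mul_right ?_ h.hB
      calc i * B ≤ _ := h3
        _ = _ := by ring
    have h6 : (b.seg + 1) * mergeParam n ≤ i + 1 := by
      refine Nat.le_of_mul_le_mul_right ?_ h.hB
      calc (b.seg + 1) * mergeParam n * B = _ := by ring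
        _ ≤ _ := h4
    rw [Nat.add_mul] at h6
    omega
  refine ⟨key, ?_⟩
  have := (Buffer.belongsTo_iff hF Nat.one_pos (by rw [key, mul_one])).1 hi
  rwa [Nat.div_one] at this

/-- If every non-full buffer of granularity `F` fails to accept `x₀`, the segment of `x₀` for `F`
has no remaining capacity. -/
theorem capAt_fine_eq_zero (h : Core x cells l p B ph s t F) (hK : 10 ^ 12 ≤ mergeParam n) {x₀ : ℝ}
    (hx : ∀ b ∈ l, b.numSeg = F → b.Accepts x₀ → emptyCount cells b.start b.size = 0) :
    capAt cells l F (segmentOf F x₀) = 0 := by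
  refine capAt_eq_zero fun b hb hi => ?_
  by_contra he
  obtain ⟨h1, h2⟩ := h.numSeg_eq_of_belongsTo hK hb he hi
  refine he (hx b hb h1 ?_)
  unfold Buffer.Accepts
  rw [h1, h2]

/-- Writing the next item into an empty cell. -/
theorem fill (h : Core x cells l p B ph s t F) (ht : t < n) {k : Fin n} (hk : cells k = none)
    (hacc : ∀ b ∈ l, b.Covers k → b.Accepts (x ⟨t, ht⟩))
    (hcF : ∀ i < F, capAt (Function.update cells k (some (x ⟨t, ht⟩))) l F i
      = prediction (n - s) F - segCount x s (t + 1) F i)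
    (hcB : ∀ i < B, capAt (Function.update cells k (some (x ⟨t, ht⟩))) l B i
      = prediction (n - s) B - segCount x s (t + 1) B i) :
    Core x (Function.update cells k (some (x ⟨t, ht⟩))) l p B ph s (t + 1) F where
  hst := h.hst.trans (Nat.le_succ t)
  htn := ht
  hB := h.hB
  hpow := h.hpow
  hF := h.hF
  seg_lt := h.seg_lt
  dvd := h.dvd
  dvd_fine := h.dvd_fine
  full b hb he := by
    refine h.full b hb ?_
    rw [emptyCount_update hk (x ⟨t, ht⟩)]
    omega
  sorted := h.sorted
  empties := by
    have := emptyCount_update hk (x ⟨t, ht⟩) 0 n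
    rw [if_pos ⟨Nat.zero_le _, by omega⟩, h.empties] at this
    omega
  accepts b hb k' v hc hv := by
    by_cases hkk : k' = k
    · subst hkk
      rw [Function.update_self] at hv
      cases hv
      exact hacc b hb hc
    · rw [Function.update_of_ne hkk] at hv
      exact h.accepts b hb k' v hc hv
  tiles := h.tiles
  hp := h.hp
  capF := hcF
  capB := hcB
  hph := h.hph
  cube := h.cube
  low := h.low
  high := h.high

end Core

/-- How the capacity of a segment develops when the next item is written into the buffer `b`: the
capacity decreases if the item comes from this segment, unless it is `0` already. -/
theorem capAt_insert {l₁ l₂ : List Buffer} {b : Buffer} {G i m : ℕ}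
    (htiles : Tiles (l₁ ++ b :: l₂) 0 p) (hst : s ≤ t) (ht : t < n) {k : Fin n}
    (hk : cells k = none) (hbk : b.Covers k)
    (hcap : capAt cells (l₁ ++ b :: l₂) G i = m - segCount x s t G i)
    (h : (b.BelongsTo G i ↔ segmentOf G (x ⟨t, ht⟩) = i) ∨ (¬ b.BelongsTo G i ∧
      (segmentOf G (x ⟨t, ht⟩) = i → capAt cells (l₁ ++ b :: l₂) G i = 0))) :
    capAt (Function.update cells k (some (x ⟨t, ht⟩))) (l₁ ++ b :: l₂) G i
      = m - segCount x s (t + 1) G i := by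
  classical
  have h1 := capAt_update htiles hk (x ⟨t, ht⟩) hbk G i
  rw [segCount_succ x hst ht]
  by_cases h2 : segmentOf G (x ⟨t, ht⟩) = i
  · rw [if_pos h2]
    rcases h with h | ⟨h, h3⟩
    · rw [if_pos (h.2 h2)] at h1
      omega
    · rw [if_neg h] at h1
      have := h3 h2
      omega
  · rw [if_neg h2]
    have : ¬ b.BelongsTo G i := by
      rcases h with h | h
      · rwa [h]
      · exact h.1
    rw [if_neg this] at h1
    omega

end Step


/-! ### Placing an item -/

section Place

variable {n : ℕ} {x : Fin n → ℝ} {cells : Fin n → Option ℝ} {l : List Buffer}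
  {p B ph s t F : ℕ}

namespace Core

/-- The heart of the analysis of a merge: if the items that overflow the regular buffers of the
parts of the segment `i` are enough to fill its dampening buffer, the regular buffers of *all*
segments are full. Indeed, one of the parts then overflows by at least `2 / 5 * (N / F) ^ (2 / 3)`,
where `N = n - s`, and this exceeds all fluctuations between segments. -/
theorem fine_le_segCount (h : Core x cells l p B ph s t F) (hg : Good x)
    (hK : 10 ^ 12 ≤ mergeParam n) (hF : F = B * mergeParam n) {i : ℕ} (hi : i < B)
    (hsum : prediction (n - s) B ≤ ∑ k ∈ Finset.range (mergeParam n),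
      max (prediction (n - s) F) (segCount x s t F (i * mergeParam n + k))) :
    ∀ j < F, prediction (n - s) F ≤ segCount x s t F j := by
  have hlarge := large_of_low hK h.low
  have hD := dampening_size (N := n - s) (B := B) (K := mergeParam n) (by omega) (hF ▸ hlarge)
  rw [← hF] at hD
  obtain ⟨k, hk, hck⟩ : ∃ k < mergeParam n, (prediction (n - s) F : ℝ)
      + 2 / 5 * (((n - s : ℕ) : ℝ) / F) ^ (2 / 3 : ℝ)
        ≤ segCount x s t F (i * mergeParam n + k) := by
    by_contra hcon
    push Not at hcon
    have hpos : 0 < (((n - s : ℕ) : ℝ) / F) ^ (2 / 3 : ℝ) := Real.rpow_pos_of_pos (by linarith) _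
    have h1 : (∑ k ∈ Finset.range (mergeParam n), (max (prediction (n - s) F)
        (segCount x s t F (i * mergeParam n + k)) : ℕ) : ℝ)
        < ∑ _k ∈ Finset.range (mergeParam n), ((prediction (n - s) F : ℝ)
          + 2 / 5 * (((n - s : ℕ) : ℝ) / F) ^ (2 / 3 : ℝ)) := by
      refine Finset.sum_lt_sum_of_nonempty (Finset.nonempty_range_iff.2 (by omega)) fun k hk => ?_
      rw [Nat.cast_max, max_lt_iff]
      exact ⟨by linarith, hcon k (Finset.mem_range.1 hk)⟩
    rw [Finset.sum_const, Finset.card_range, nsmul_eq_mul, ← Nat.cast_sum] at h1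
    have h2 := (Nat.cast_le (α := ℝ)).2 hsum
    exact absurd (h2.trans_lt (h1.trans_le hD)) (lt_irrefl _)
  have hlt : i * mergeParam n + k < F := by
    rw [hF]
    calc i * mergeParam n + k < i * mergeParam n + mergeParam n := by omega
      _ = (i + 1) * mergeParam n := by ring
      _ ≤ _ := Nat.mul_le_mul_right _ hi
  intro j hj
  exact prediction_le_of_large (hg.count F _ s t hlt h.hst h.htn h.low)
    (hg.count F j s t hj h.hst h.htn h.low) hck

theorem fine_full (h : Core x cells l p B ph s t F)
    (hc : ∀ j < F, prediction (n - s) F ≤ segCount x s t F j) {b : Buffer} (hb : b ∈ l)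
    (hbF : b.numSeg = F) : emptyCount cells b.start b.size = 0 := by
  have hpos := h.numSeg_pos hb
  have hlt := h.seg_lt b hb
  have h1 : b.BelongsTo F b.seg :=
    (Buffer.belongsTo_iff (hbF ▸ hpos) Nat.one_pos (by rw [hbF, mul_one])).2 (Nat.div_one _)
  have h2 := emptyCount_le_capAt (cells := cells) hb h1
  rw [h.capF b.seg (hbF ▸ hlt), Nat.sub_eq_zero_of_le (hc _ (hbF ▸ hlt))] at h2
  omega

/-- As long as the current segments have remaining capacity, some buffer takes the next item. -/
theorem exists_buffer (h : Core x cells l p B ph s t F) (hg : Good x)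
    (hK : 10 ^ 12 ≤ mergeParam n) {x₀ : ℝ} (hcap : ∀ i < B, capAt cells l B i ≠ 0) :
    ∃ b ∈ l, b.Accepts x₀ ∧ emptyCount cells b.start b.size ≠ 0 := by
  by_contra hcon
  push Not at hcon
  have hK0 : 0 < mergeParam n := by omega
  have hfine := h.capAt_fine_eq_zero hK fun b hb _ hx => hcon b hb hx
  rcases h.hF with hF | hF
  · subst hF
    exact hcap _ (segmentOf_lt h.hB x₀) hfine
  set i := segmentOf B x₀ with hi
  have hiB : i < B := segmentOf_lt h.hB x₀
  have hB1 : ∀ b ∈ l, b.BelongsTo B i → b.numSeg = B → b.Accepts x₀ := by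
    intro b hb hbi hbB
    have := (Buffer.belongsTo_iff h.hB Nat.one_pos (by rw [hbB, mul_one])).1 hbi
    rw [Nat.div_one] at this
    unfold Buffer.Accepts
    rw [hbB, this]
  have h1 := capAt_le_sum cells h.hB hK0 (l := l) (i := i) (by
    intro b hb hbi he
    refine ⟨h.numSeg_pos hb, ?_⟩
    rw [← hF]
    refine h.dvd_fine b hb fun hbB => he (hcon b hb (hB1 b hb hbi hbB)))
  have hlt : ∀ k < mergeParam n, i * mergeParam n + k < F := by
    intro k hk
    rw [hF]
    calc i * mergeParam n + k < i * mergeParam n + mergeParam n := by omega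
      _ = (i + 1) * mergeParam n := by ring
      _ ≤ _ := Nat.mul_le_mul_right _ hiB
  have hc := h.fine_le_segCount hg hK hF hiB (by
    rw [h.capB i hiB, ← sum_segCount_mul x s t B hK0 i, ← hF] at h1
    have h2 : ∑ k ∈ Finset.range (mergeParam n), capAt cells l F (i * mergeParam n + k)
        + ∑ k ∈ Finset.range (mergeParam n), segCount x s t F (i * mergeParam n + k)
        = ∑ k ∈ Finset.range (mergeParam n),
          max (prediction (n - s) F) (segCount x s t F (i * mergeParam n + k)) := by
      rw [← Finset.sum_add_distrib]
      refine Finset.sum_congr rfl fun k hk => ?_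
      rw [h.capF _ (hlt k (Finset.mem_range.1 hk))]
      omega
    omega)
  refine hcap i hiB (capAt_eq_zero fun b hb hbi => ?_)
  by_contra he
  rcases h.full b hb he with hbF | hbB
  · exact he (h.fine_full hc hb hbF)
  · exact he (hcon b hb (hB1 b hb hbi hbB))

/-- The next item goes to a buffer, if some non-full buffer accepts it. -/
theorem insert_buffer (h : Core x cells l p B ph s t F) (hK : 10 ^ 12 ≤ mergeParam n) (ht : t < n)
    {k : Fin n} {l₁ l₂ : List Buffer} {b : Buffer} (hl : l = l₁ ++ b :: l₂)
    (hbx : b.Accepts (x ⟨t, ht⟩)) (hbk : b.Covers k) (hk : cells k = none)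
    (hfirst : ∀ b' ∈ l₁, b'.Accepts (x ⟨t, ht⟩) → emptyCount cells b'.start b'.size = 0) :
    Core x (Function.update cells k (some (x ⟨t, ht⟩))) l p B ph s (t + 1) F := by
  subst hl
  have hb : b ∈ l₁ ++ b :: l₂ := by simp
  have hpos := h.numSeg_pos hb
  refine h.fill ht hk ?_ ?_ ?_
  · intro b' hb' hc
    rw [List.mem_append, List.mem_cons] at hb'
    rcases hb' with hb' | rfl | hb'
    · exact absurd hc (h.tiles.notCovers hbk b' (List.mem_append_left _ hb'))
    · exact hbx
    · exact absurd hc (h.tiles.notCovers hbk b' (List.mem_append_right _ hb'))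
  · intro i hi
    refine capAt_insert h.tiles h.hst ht hk hbk (h.capF i hi) ?_
    by_cases hdvd : F ∣ b.numSeg
    · exact Or.inl (hbx.belongsTo_iff (h.F_pos hK) hdvd hpos)
    right
    have he : emptyCount cells b.start b.size ≠ 0 := (emptyCount_pos_of hk hbk.1 hbk.2).ne'
    have hbB : b.numSeg = B := by
      by_contra hc
      exact hdvd (h.dvd_fine b hb hc)
    constructor
    · intro hi
      exact hdvd (h.numSeg_eq_of_belongsTo hK hb he hi).1.symm.dvd
    · rintro rfl
      refine h.capAt_fine_eq_zero hK fun b' hb' hbF hx => ?_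
      rw [List.mem_append, List.mem_cons] at hb'
      rcases hb' with hb' | rfl | hb'
      · exact hfirst b' hb' hx
      · exact absurd hbF.symm.dvd hdvd
      -- A younger buffer is at most as fine as `b`, so it is not of granularity `F`.
      · exfalso
        have h1 := (List.pairwise_cons.1 (List.pairwise_append.1 h.sorted).2.1).1 b' hb'
        have h2 := h.B_le_F hK
        exact hdvd (Dvd.intro 1 (by omega))
  · intro i hi
    exact capAt_insert h.tiles h.hst ht hk hbk (h.capB i hi)
      (Or.inl (hbx.belongsTo_iff h.hB (h.dvd b hb) hpos))

theorem sum_capAt_add_pool (h : Core x cells l p B ph s t F) :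
    ∑ i ∈ Finset.range B, capAt cells l B i + emptyCount cells p (n - p) = n - t := by
  rw [sum_capAt cells h.hB fun b hb => ⟨h.seg_lt b hb, h.dvd b hb⟩,
    ← h.tiles.emptyCount_eq cells, Nat.sub_zero, ← h.empties]
  have h1 := emptyCount_add cells 0 p (n - p)
  rw [Nat.add_sub_cancel' h.hp, zero_add] at h1
  exact h1.symm

/-- In a phase without a merge, the next item finds an empty cell of the pool if all buffers that
accept it are full. Otherwise, the future items would have to fit exactly into the buffers, because
every segment still receives enough items to fill its buffers; but then no further item from the
segment of the next item could arrive. -/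
theorem pool_ne_zero (h : Core x cells l p B ph s t B) (hg : Good x)
    (hK : 10 ^ 12 ≤ mergeParam n) (ht : t < n)
    (hfull : ∀ b ∈ l, b.Accepts (x ⟨t, ht⟩) → emptyCount cells b.start b.size = 0) :
    emptyCount cells p (n - p) ≠ 0 := by
  intro h0
  have h1 := h.sum_capAt_add_pool
  rw [h0, add_zero] at h1
  have hlarge := large_of_low hK h.low
  have h2 : ∀ i < B, capAt cells l B i ≤ segCount x t n B i := by
    intro i hi
    rw [h.capB i hi]
    have h3 := prediction_le_of_all hlarge
      (hg.count B i s n hi (h.hst.trans h.htn) le_rfl h.low)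
    rw [← segCount_add x h.hst h.htn] at h3
    omega
  have h4 : ∑ i ∈ Finset.range B, capAt cells l B i < ∑ i ∈ Finset.range B, segCount x t n B i := by
    refine Finset.sum_lt_sum (fun i hi => h2 i (Finset.mem_range.1 hi))
      ⟨segmentOf B (x ⟨t, ht⟩), Finset.mem_range.2 (segmentOf_lt h.hB _), ?_⟩
    rw [h.capAt_fine_eq_zero hK fun b hb _ hx => hfull b hb hx,
      ← segCount_add x (Nat.le_succ t) ht, segCount_single x ht, if_pos rfl]
    omega
  rw [sum_segCount x h.hB le_rfl] at h4
  omega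

/-- Placing the next item into the pool. -/
theorem insert_pool (h : Core x cells l p B ph s t B) (hK : 10 ^ 12 ≤ mergeParam n) (ht : t < n)
    (hfull : ∀ b ∈ l, b.Accepts (x ⟨t, ht⟩) → emptyCount cells b.start b.size = 0)
    {k : Fin n} (hk : cells k = none) (hpk : p ≤ k) :
    Core x (Function.update cells k (some (x ⟨t, ht⟩))) l p B ph s (t + 1) B := by
  have hnot : ∀ b ∈ l, ¬ b.Covers k := by
    intro b hb hc
    have := h.tiles.bounds hb
    unfold Buffer.Covers at hc
    omega
  have h1 := h.capAt_fine_eq_zero hK fun b hb _ hx => hfull b hb hx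
  have key : ∀ i < B, capAt (Function.update cells k (some (x ⟨t, ht⟩))) l B i
      = prediction (n - s) B - segCount x s (t + 1) B i := by
    intro i hi
    rw [capAt_update_of_notCovers hk _ hnot, segCount_succ x h.hst ht, h.capB i hi]
    split_ifs with h2
    · rw [h2, h.capB i hi] at h1
      omega
    · rfl
  exact h.fill ht hk (fun b hb hc => absurd hc (hnot b hb)) key key

end Core

/-- Placing an item preserves the invariant. -/
theorem Inv.insertItem {st : State n} (h : Inv x t st s F) (hg : Good x)
    (hK : 10 ^ 12 ≤ mergeParam n) (ht : t < n)
    (hact : st.last = false → ∀ i < st.numSeg, st.capacity i ≠ 0) :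
    Inv x (t + 1) (st.insertItem (x ⟨t, ht⟩)) s F := by
  classical
  have hc := h.core
  by_cases hex : ∃ b ∈ st.buffers, b.Accepts (x ⟨t, ht⟩) ∧ emptyCount st.cells b.start b.size ≠ 0
  · obtain ⟨k, l₁, b, l₂, hl, hbx, hbk, hk, hfind, hfirst⟩ := exists_findSome hex
    have hreg : st.regularCell (x ⟨t, ht⟩) = some k := by
      unfold State.regularCell
      rw [h.failed]
      simp only [Bool.false_eq_true, if_false]
      rw [hfind]
      rfl
    have hins : st.insertItem (x ⟨t, ht⟩)
        = { st with cells := Function.update st.cells k (some (x ⟨t, ht⟩)) } := by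
      unfold State.insertItem State.cellFor
      rw [hreg]
      simp [h.failed]
    have hkp : (k : ℕ) < st.poolStart := by
      have := hc.tiles.bounds (b := b) (by rw [hl]; simp)
      unfold Buffer.Covers at hbk
      omega
    rw [hins]
    refine ⟨hc.insert_buffer hK ht hl hbx hbk hk hfirst, h.failed, h.items, h.batches, ?_, h.final⟩
    intro hlast
    obtain ⟨h1, h2, h3⟩ := h.running hlast
    refine ⟨h1, ?_, ?_⟩
    · intro k' hk'
      dsimp only at hk' ⊢
      rw [Function.update_of_ne (by rintro rfl; omega)]
      exact h2 k' hk'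
    · intro i hi
      have h4 := hact hlast i hi
      rw [State.capacity_eq, hc.capB i hi] at h4
      dsimp only at hi ⊢
      rw [segCount_succ x hc.hst ht]
      split_ifs <;> omega
  · have hlast : st.last = true := by
      by_contra hl
      rw [Bool.not_eq_true] at hl
      exact hex (hc.exists_buffer hg hK fun i hi => by
        rw [← State.capacity_eq]; exact hact hl i hi)
    push Not at hex
    obtain ⟨hF, hpool⟩ := h.final hlast
    subst hF
    have hne := hc.pool_ne_zero hg hK ht hex
    obtain ⟨k, hk⟩ := Option.ne_none_iff_exists'.1 (mt firstEmpty_eq_none.1 hne)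
    have hreg : st.regularCell (x ⟨t, ht⟩) = some k := by
      unfold State.regularCell
      rw [h.failed, hlast]
      simp only [Bool.false_eq_true, if_false, if_true]
      rw [findSome_eq_none hex, hk]
      rfl
    have hins : st.insertItem (x ⟨t, ht⟩)
        = { st with cells := Function.update st.cells k (some (x ⟨t, ht⟩)) } := by
      unfold State.insertItem State.cellFor
      rw [hreg]
      simp [h.failed]
    rw [hins]
    refine ⟨hc.insert_pool hK ht hex (firstEmpty_isNone hk) (mem_of_firstEmpty hk).1, h.failed,
      h.items, h.batches, ?_, h.final⟩
    intro hl
    dsimp only at hl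
    rw [hlast] at hl
    cases hl

end Place


/-! ### The start of a phase -/

section NewPhase

variable {n : ℕ} {x : Fin n → ℝ} {cells : Fin n → Option ℝ} {l : List Buffer}
  {p B ph s t F : ℕ}

/-- Allocating one buffer to each of `B` segments at the start of a phase, at a time when all
non-full buffers have granularity `F`. -/
theorem core_append_allocate (hs : s ≤ n) (hB : 0 < B) (hFpos : 0 < F)
    (hpow : ∃ a, B = mergeParam n ^ a)
    (hF : F = B ∨ F = B * mergeParam n) (seg_lt : ∀ b ∈ l, b.seg < b.numSeg)
    (dvd : ∀ b ∈ l, F ∣ b.numSeg)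
    (full : ∀ b ∈ l, emptyCount cells b.start b.size ≠ 0 → b.numSeg = F)
    (sorted : l.Pairwise fun b b' => b'.numSeg ≤ b.numSeg)
    (empties : emptyCount cells 0 n = n - s)
    (accepts : ∀ b ∈ l, ∀ (k : Fin n) (v : ℝ), b.Covers k → cells k = some v → b.Accepts v)
    (tiles : Tiles l 0 p) (pool : ∀ k : Fin n, p ≤ k → cells k = none) (size : ℕ → ℕ)
    (capF : ∀ i < F, capAt cells (l ++ allocate p B size) F i = prediction (n - s) F)
    (capB : ∀ i < B, capAt cells (l ++ allocate p B size) B i = prediction (n - s) B)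
    (hfit : p + ∑ i ∈ Finset.range B, size i ≤ n) (hph : 1 ≤ ph)
    (cube : (n - s) ^ 3 * mergeParam n ^ ph ≤ n ^ 3 * mergeParam n)
    (low : (mergeParam n : ℝ) ^ (2 / 3 : ℝ) / 4 ≤ ((n - s : ℕ) : ℝ) / F)
    (high : ((n - s : ℕ) : ℝ) / B ≤ (mergeParam n : ℝ) ^ 3) :
    Core x cells (l ++ allocate p B size) (p + ∑ i ∈ Finset.range B, size i) B ph s s F := by
  have hBF : B ∣ F := by
    rcases hF with hF | hF
    · exact hF ▸ dvd_rfl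
    · exact hF ▸ Dvd.intro _ rfl
  have hnew : ∀ b ∈ allocate p B size, b.numSeg = B ∧ b.seg < B ∧ p ≤ b.start := by
    intro b hb
    obtain ⟨i, hi, rfl⟩ := mem_allocate.1 hb
    exact ⟨rfl, hi, Nat.le_add_right _ _⟩
  refine ⟨le_rfl, hs, hB, hpow, hF, ?_, ?_, ?_, ?_, ?_, empties, ?_,
    tiles_append.2 ⟨p, tiles, tiles_allocate _ _ _⟩, hfit, ?_, ?_, hph, cube, low, high⟩
  · intro b hb
    rcases List.mem_append.1 hb with hb | hb
    · exact seg_lt b hb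
    · rw [(hnew b hb).1]
      exact (hnew b hb).2.1
  · intro b hb
    rcases List.mem_append.1 hb with hb | hb
    · exact hBF.trans (dvd b hb)
    · rw [(hnew b hb).1]
  · intro b hb hne
    rcases List.mem_append.1 hb with hb | hb
    · exact dvd b hb
    · exact absurd (hnew b hb).1 hne
  · intro b hb he
    rcases List.mem_append.1 hb with hb | hb
    · exact Or.inl (full b hb he)
    · exact Or.inr (hnew b hb).1
  · rw [List.pairwise_append]
    refine ⟨sorted, ?_, ?_⟩
    · refine List.pairwise_of_forall_mem_list fun b hb b' hb' => ?_
      rw [(hnew b hb).1, (hnew b' hb').1]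
    · intro b hb b' hb'
      rw [(hnew b' hb').1]
      exact (Nat.le_of_dvd hFpos hBF).trans
        (Nat.le_of_dvd ((Nat.zero_le _).trans_lt (seg_lt b hb)) (dvd b hb))
  · intro b hb k v hc hv
    rcases List.mem_append.1 hb with hb | hb
    · exact accepts b hb k v hc hv
    · rw [pool k ((hnew b hb).2.2.trans hc.1)] at hv
      cases hv
  · intro i hi
    rw [capF i hi, segCount_self, Nat.sub_zero]
  · intro i hi
    rw [capB i hi, segCount_self, Nat.sub_zero]

/-- The start of a phase, after the allocation of the regular buffers. -/
theorem core_allocate (hs : s ≤ n) (hB : 0 < B) (hpow : ∃ a, B = mergeParam n ^ a)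
    (seg_lt : ∀ b ∈ l, b.seg < b.numSeg) (dvd : ∀ b ∈ l, B ∣ b.numSeg)
    (full : ∀ b ∈ l, emptyCount cells b.start b.size ≠ 0 → b.numSeg = B)
    (sorted : l.Pairwise fun b b' => b'.numSeg ≤ b.numSeg)
    (empties : emptyCount cells 0 n = n - s)
    (accepts : ∀ b ∈ l, ∀ (k : Fin n) (v : ℝ), b.Covers k → cells k = some v → b.Accepts v)
    (tiles : Tiles l 0 p) (pool : ∀ k : Fin n, p ≤ k → cells k = none) (size : ℕ → ℕ)
    (hsize : ∀ i < B, capAt cells l B i + size i = prediction (n - s) B)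
    (hfit : p + ∑ i ∈ Finset.range B, size i ≤ n) (hph : 1 ≤ ph)
    (cube : (n - s) ^ 3 * mergeParam n ^ ph ≤ n ^ 3 * mergeParam n)
    (low : (mergeParam n : ℝ) ^ (2 / 3 : ℝ) / 4 ≤ ((n - s : ℕ) : ℝ) / B)
    (high : ((n - s : ℕ) : ℝ) / B ≤ (mergeParam n : ℝ) ^ 3) :
    Core x cells (l ++ allocate p B size) (p + ∑ i ∈ Finset.range B, size i) B ph s s B := by
  have key : ∀ i < B, capAt cells (l ++ allocate p B size) B i = prediction (n - s) B := by
    intro i hi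
    rw [capAt_append, capAt_allocate hB hfit pool hi, hsize i hi]
  exact core_append_allocate hs hB hB hpow (Or.inl rfl) seg_lt dvd full sorted empties accepts tiles
    pool size key key hfit hph cube low high

/-- The start of a phase with a merge, after the allocation of the dampening buffers. -/
theorem Core.merge (h : Core x cells l p (B * mergeParam n) ph s s (B * mergeParam n))
    (hK : 10 ^ 12 ≤ mergeParam n) (hpow : ∃ a, B = mergeParam n ^ a)
    (pool : ∀ k : Fin n, p ≤ k → cells k = none)
    (hD : mergeParam n * prediction (n - s) (B * mergeParam n) ≤ prediction (n - s) B)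
    (hfit : p + B *
      (prediction (n - s) B - mergeParam n * prediction (n - s) (B * mergeParam n)) ≤ n)
    (high : ((n - s : ℕ) : ℝ) / B ≤ (mergeParam n : ℝ) ^ 3) :
    Core x cells (l ++ allocate p B fun _ =>
        prediction (n - s) B - mergeParam n * prediction (n - s) (B * mergeParam n))
      (p + ∑ _i ∈ Finset.range B,
        (prediction (n - s) B - mergeParam n * prediction (n - s) (B * mergeParam n)))
      B ph s s (B * mergeParam n) := by
  have hB : 0 < B := Nat.pos_of_mul_pos_right h.hB
  have hcap : ∀ i < B * mergeParam n,
      capAt cells l (B * mergeParam n) i = prediction (n - s) (B * mergeParam n) := by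
    intro i hi
    rw [h.capB i hi, segCount_self, Nat.sub_zero]
  have hfit' : p + ∑ _i ∈ Finset.range B, (prediction (n - s) B
      - mergeParam n * prediction (n - s) (B * mergeParam n)) ≤ n := by
    simpa using hfit
  refine core_append_allocate h.htn hB h.hB hpow (Or.inr rfl) h.seg_lt h.dvd
    (fun b hb he => (h.full b hb he).elim id id) h.sorted h.empties h.accepts h.tiles pool _
    ?_ ?_ hfit' h.hph h.cube h.low high
  · intro i hi
    rw [capAt_append, capAt_allocate_fine _ _ _ hB (by omega), hcap i hi, add_zero]
  · intro i hi
    rw [capAt_append, capAt_allocate hB hfit' pool hi,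
      capAt_eq_sum cells hB (by omega) (fun b hb => ⟨h.numSeg_pos hb, h.dvd b hb⟩),
      Finset.sum_congr rfl fun k hk => hcap _ ?_]
    · rw [Finset.sum_const, Finset.card_range, smul_eq_mul]
      omega
    · have := Finset.mem_range.1 hk
      calc i * mergeParam n + k < i * mergeParam n + mergeParam n := by omega
        _ = (i + 1) * mergeParam n := by ring
        _ ≤ _ := Nat.mul_le_mul_right _ hi

/-- When a phase ends, all buffers of a finer granularity than the current one are full. -/
theorem Core.full_of_capAt_eq_zero (h : Core x cells l p B ph s t F) (hg : Good x)
    (hK : 10 ^ 12 ≤ mergeParam n) {i : ℕ} (hi : i < B) (h0 : capAt cells l B i = 0) :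
    ∀ b ∈ l, emptyCount cells b.start b.size ≠ 0 → b.numSeg = B := by
  intro b hb he
  rcases h.full b hb he with hbF | hbB
  · rcases h.hF with hF | hF
    · exact hbF.trans hF
    · have hK0 : 0 < mergeParam n := by omega
      rw [h.capB i hi, ← sum_segCount_mul x s t B hK0 i, ← hF] at h0
      have h1 : ∑ k ∈ Finset.range (mergeParam n), segCount x s t F (i * mergeParam n + k)
          ≤ ∑ k ∈ Finset.range (mergeParam n),
            max (prediction (n - s) F) (segCount x s t F (i * mergeParam n + k)) :=
        Finset.sum_le_sum fun k _ => le_max_right _ _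
      exact absurd (h.fine_full (h.fine_le_segCount hg hK hF hi (by omega)) hb hbF) he
  · exact hbB

/-- The state after the allocation of the regular buffers of a phase that starts with `N` future
items. -/
noncomputable def State.regular (st : State n) (N : ℕ) : State n :=
  { st with
    buffers := st.buffers ++ allocate st.poolStart st.numSeg
      fun i => prediction N st.numSeg - st.capacity i
    poolStart := st.poolStart
      + ∑ i ∈ Finset.range st.numSeg, (prediction N st.numSeg - st.capacity i)
    phase := st.phase + 1
    phaseItems := N }

theorem State.newPhase_eq {st : State n} {N : ℕ} (hN : emptyCount st.cells 0 n = N)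
    (h1 : (N : ℝ) / st.numSeg ≤ ((st.phaseItems : ℝ) / st.numSeg) ^ (2 / 3 : ℝ))
    (h2 : ∀ i < st.numSeg, st.capacity i < prediction N st.numSeg)
    (h3 : (st.regular N).poolStart ≤ n) :
    st.newPhase = if st.numSeg * mergeParam n ≤ n - (st.regular N).poolStart then st.regular N
      else if mergeParam n < st.numSeg then (st.regular N).merge N (prediction N st.numSeg)
      else { st.regular N with last := true } := by
  subst hN
  unfold State.newPhase
  dsimp only
  rw [if_neg (not_lt.2 h1), if_neg (by push Not; exact h2)]
  exact if_neg (not_lt.2 h3)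

theorem capacity_ne_zero_of_core {st : State n} (hK : 10 ^ 12 ≤ mergeParam n)
    (h : Core x st.cells st.buffers st.poolStart st.numSeg st.phase s s F) :
    ∀ i < st.numSeg, st.capacity i ≠ 0 := by
  intro i hi
  have hlarge := large_of_low hK (h.lowB hK)
  have := prediction_pos (N := n - s) (B := st.numSeg) (by linarith)
  rw [State.capacity_eq, h.capB i hi, segCount_self]
  omega

/-- A merge at the start of a phase establishes the invariant. -/
theorem inv_merge {st : State n}
    (h : Core x st.cells st.buffers st.poolStart st.numSeg st.phase s s st.numSeg)
    (hK : 10 ^ 12 ≤ mergeParam n) (hfailed : st.failed = false) (hlast : st.last = false)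
    (hitems : st.phaseItems = n - s)
    (hbat : ∃ c < 2 * st.phase, Batches (mergeParam n ^ 3) st.buffers st.poolStart c)
    (hpool : ∀ k : Fin n, st.poolStart ≤ k → st.cells k = none)
    (hhigh : ((n - s : ℕ) : ℝ) / st.numSeg ≤ (mergeParam n : ℝ) ^ 2)
    (hB : mergeParam n < st.numSeg) :
    Inv x s (st.merge (n - s) (prediction (n - s) st.numSeg)) s st.numSeg ∧
      ∀ i < (st.merge (n - s) (prediction (n - s) st.numSeg)).numSeg,
        (st.merge (n - s) (prediction (n - s) st.numSeg)).capacity i ≠ 0 := by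
  have hK' : (1000000000000 : ℝ) ≤ mergeParam n := by exact_mod_cast hK
  have hK0 : 0 < mergeParam n := by omega
  have hKr : (0 : ℝ) < mergeParam n := by exact_mod_cast hK0
  have hlarge := large_of_low hK h.low
  obtain ⟨a, ha⟩ := h.hpow
  have ha1 : 1 ≤ a := by
    by_contra hcon
    obtain rfl : a = 0 := by omega
    rw [pow_zero] at ha
    omega
  obtain ⟨B, hBa⟩ : ∃ B, B = mergeParam n ^ (a - 1) := ⟨_, rfl⟩
  have hBB : st.numSeg = B * mergeParam n := by
    rw [ha, hBa, ← pow_succ, Nat.sub_add_cancel ha1]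
  have hB0 : 0 < B := by
    rw [hBa]
    positivity
  have hdiv : st.numSeg / mergeParam n = B := by rw [hBB, Nat.mul_div_cancel _ hK0]
  have hBr : (0 : ℝ) < B := by exact_mod_cast hB0
  have hmul : ((n - s : ℕ) : ℝ) / B = mergeParam n * (((n - s : ℕ) : ℝ) / st.numSeg) := by
    rw [hBB]
    push_cast
    field_simp
  have hKle : (mergeParam n : ℝ) ≤ ((n - s : ℕ) : ℝ) / B := by
    rw [hmul]
    exact le_mul_of_one_le_right hKr.le (by linarith)
  have hlargeB : 1000000 ≤ ((n - s : ℕ) : ℝ) / B := by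
    linarith
  have hhighB : ((n - s : ℕ) : ℝ) / B ≤ (mergeParam n : ℝ) ^ 3 := by
    rw [hmul]
    calc (mergeParam n : ℝ) * (((n - s : ℕ) : ℝ) / st.numSeg)
        ≤ mergeParam n * mergeParam n ^ 2 := by gcongr
      _ = _ := by ring
  have hD : mergeParam n * prediction (n - s) st.numSeg < prediction (n - s) B := by
    have h1 := dampening_size (N := n - s) (B := B) (K := mergeParam n) (by omega)
      (by rw [← hBB]; exact hlarge)
    rw [← hBB] at h1
    have h2 : 0 < (((n - s : ℕ) : ℝ) / st.numSeg) ^ (2 / 3 : ℝ) :=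
      Real.rpow_pos_of_pos (by linarith) _
    have h3 : (mergeParam n : ℝ) * prediction (n - s) st.numSeg < prediction (n - s) B := by
      nlinarith
    exact_mod_cast h3
  have hBm := mul_prediction_le hlargeB
  have hpredK : prediction (n - s) B ≤ mergeParam n ^ 3 := by
    have := (prediction_le_div hlargeB).trans hhighB
    exact_mod_cast this
  -- After the merge the buffers have `B * m(N, B)` empty cells. This is at most the number `N` of
  -- future items, which equals the number of empty cells.
  have hfit : st.poolStart
      + B * (prediction (n - s) B - mergeParam n * prediction (n - s) st.numSeg) ≤ n := by
    have h1 : B * (prediction (n - s) B - mergeParam n * prediction (n - s) st.numSeg)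
        + st.numSeg * prediction (n - s) st.numSeg = B * prediction (n - s) B := by
      conv_lhs => rw [show st.numSeg * prediction (n - s) st.numSeg
        = B * (mergeParam n * prediction (n - s) st.numSeg) by rw [← mul_assoc, ← hBB]]
      rw [← mul_add, Nat.sub_add_cancel hD.le]
    have h2 := h.sum_capAt_add_pool
    have h3 := h.hp
    rw [emptyCount_of_empty (by omega) fun k hk _ => hpool k hk,
      Finset.sum_congr rfl fun i hi => (h.capB i (Finset.mem_range.1 hi)).trans
        (by rw [segCount_self, Nat.sub_zero]), Finset.sum_const, Finset.card_range,
      smul_eq_mul] at h2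
    omega
  have hmerge : st.merge (n - s) (prediction (n - s) st.numSeg)
      = { st with
          buffers := st.buffers ++ allocate st.poolStart B
            fun _ => prediction (n - s) B - mergeParam n * prediction (n - s) st.numSeg
          poolStart := st.poolStart + ∑ _i ∈ Finset.range B,
            (prediction (n - s) B - mergeParam n * prediction (n - s) st.numSeg)
          numSeg := B } := by
    unfold State.merge
    dsimp only
    rw [hdiv, if_neg (by omega), Finset.sum_const, Finset.card_range, smul_eq_mul]
  have hcore : Core x st.cells (st.buffers ++ allocate st.poolStart B
      fun _ => prediction (n - s) B - mergeParam n * prediction (n - s) st.numSeg)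
      (st.poolStart + ∑ _i ∈ Finset.range B,
        (prediction (n - s) B - mergeParam n * prediction (n - s) st.numSeg)) B st.phase s s
      st.numSeg := by
    rw [hBB] at h hD hfit ⊢
    exact h.merge hK ⟨a - 1, hBa⟩ hpool hD.le hfit hhighB
  rw [hmerge]
  obtain ⟨c, hc, hb⟩ := hbat
  refine ⟨⟨hcore, hfailed, hitems, ⟨c + 1, hc, .append B _ hb hB0
    fun _ _ => ⟨Nat.sub_pos_of_lt hD, (Nat.sub_le _ _).trans hpredK⟩⟩, fun _ => ⟨hKle, ?_, ?_⟩, ?_⟩,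
    capacity_ne_zero_of_core (F := st.numSeg) hK hcore⟩
  · intro k hk
    exact hpool k ((Nat.le_add_right _ _).trans hk)
  · intro i _
    rw [segCount_self]
    exact Nat.zero_le _
  · intro hl
    exact absurd (hlast.symm.trans hl) (by simp)

/-- The start of a new phase preserves the invariant, and afterwards all current segments have
remaining capacity. -/
theorem Inv.newPhase {st : State n} (h : Inv x t st s F) (hg : Good x)
    (hK : 10 ^ 12 ≤ mergeParam n) (hlast : st.last = false)
    (hend : ∃ i < st.numSeg, st.capacity i = 0) :
    ∃ F', Inv x t st.newPhase t F' ∧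
      (st.newPhase.last = false → ∀ i < st.newPhase.numSeg, st.newPhase.capacity i ≠ 0) := by
  have hc := h.core
  obtain ⟨hM, hpool, hle⟩ := h.running hlast
  obtain ⟨i₀, hi₀, h0⟩ := hend
  rw [State.capacity_eq] at h0
  have hB := hc.hB
  have hK' : (1000000000000 : ℝ) ≤ mergeParam n := by exact_mod_cast hK
  have hNT : n - s - (t - s) = n - t := by have := hc.hst; omega
  have hTN : t - s ≤ n - s := Nat.sub_le_sub_right hc.htn s
  have hlarge : 1000000 ≤ ((n - s : ℕ) : ℝ) / st.numSeg := by
    linarith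
  have hcount := fun i hi => hg.count st.numSeg i s t hi hc.hst hc.htn (hc.lowB hK)
  have hup : ((n - t : ℕ) : ℝ) / st.numSeg
      ≤ 11 / 20 * (((n - s : ℕ) : ℝ) / st.numSeg) ^ (2 / 3 : ℝ) := by
    rw [← hNT]
    refine div_le_of_prediction_le hTN (hcount i₀ hi₀) ?_
    rw [hc.capB i₀ hi₀] at h0
    omega
  have hlow : (mergeParam n : ℝ) ^ (2 / 3 : ℝ) / 4 ≤ ((n - t : ℕ) : ℝ) / st.numSeg := by
    rw [← hNT]
    refine le_trans ?_ (le_div_of_le_mul_prediction hlarge hTN ?_)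
    · gcongr
    · rw [← sum_segCount x hB hc.htn]
      calc _ ≤ ∑ _i ∈ Finset.range st.numSeg, prediction (n - s) st.numSeg :=
            Finset.sum_le_sum fun i hi => hle i (Finset.mem_range.1 hi)
        _ = _ := by rw [Finset.sum_const, Finset.card_range, smul_eq_mul]
  have hlarge' := large_of_low hK hlow
  have hpow0 : 0 ≤ (((n - s : ℕ) : ℝ) / st.numSeg) ^ (2 / 3 : ℝ) := by positivity
  have hup' : ((n - t : ℕ) : ℝ) / st.numSeg
      ≤ (((n - s : ℕ) : ℝ) / st.numSeg) ^ (2 / 3 : ℝ) := by linarith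
  have hhigh : ((n - t : ℕ) : ℝ) / st.numSeg ≤ (mergeParam n : ℝ) ^ 2 :=
    hup'.trans (rpow_two_thirds_le (by positivity) (by positivity) hc.high)
  have hhigh3 : ((n - t : ℕ) : ℝ) / st.numSeg ≤ (mergeParam n : ℝ) ^ 3 :=
    hhigh.trans (pow_le_pow_right₀ (by linarith) (by norm_num))
  have hcap : ∀ i < st.numSeg, st.capacity i < prediction (n - t) st.numSeg := by
    intro i hi
    rw [State.capacity_eq, hc.capB i hi, ← hNT]
    rw [← hNT] at hlarge' hup
    exact prediction_sub_lt hTN (hcount i hi) hlarge' hup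
  have hcube : (n - t) ^ 3 * mergeParam n ^ (st.phase + 1) ≤ n ^ 3 * mergeParam n := by
    calc (n - t) ^ 3 * mergeParam n ^ (st.phase + 1)
        = ((n - t) ^ 3 * mergeParam n) * mergeParam n ^ st.phase := by ring
      _ ≤ (n - s) ^ 3 * mergeParam n ^ st.phase :=
        Nat.mul_le_mul_right _ (cube_mul_le hB hM hup')
      _ ≤ _ := hc.cube
  -- The regular buffers fit into the pool, as the predicted number of items is at most the actual
  -- number of future items, which equals the number of empty cells.
  have hsum : ∑ i ∈ Finset.range st.numSeg, st.capacity i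
      + ∑ i ∈ Finset.range st.numSeg, (prediction (n - t) st.numSeg - st.capacity i)
      = st.numSeg * prediction (n - t) st.numSeg := by
    rw [← Finset.sum_add_distrib, Finset.sum_congr rfl fun i hi =>
      Nat.add_sub_cancel' (hcap i (Finset.mem_range.1 hi)).le, Finset.sum_const, Finset.card_range,
      smul_eq_mul]
  have hempties : ∑ i ∈ Finset.range st.numSeg, st.capacity i
      + emptyCount st.cells st.poolStart (n - st.poolStart) = n - t := hc.sum_capAt_add_pool
  rw [emptyCount_of_empty (by have := hc.hp; omega) fun k hk _ => hpool k hk] at hempties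
  have hBm := mul_prediction_le hlarge'
  have hp := hc.hp
  have hstart : (st.regular (n - t)).poolStart = st.poolStart
      + ∑ i ∈ Finset.range st.numSeg, (prediction (n - t) st.numSeg - st.capacity i) := rfl
  have hfit : (st.regular (n - t)).poolStart ≤ n := by omega
  have hpredK : prediction (n - t) st.numSeg ≤ mergeParam n ^ 3 := by
    have := (prediction_le_div hlarge').trans hhigh3
    exact_mod_cast this
  have hcore : Core x st.cells (st.regular (n - t)).buffers (st.regular (n - t)).poolStart st.numSeg
      (st.phase + 1) t t st.numSeg :=
    core_allocate hc.htn hB hc.hpow hc.seg_lt hc.dvd (hc.full_of_capAt_eq_zero hg hK hi₀ h0)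
      hc.sorted hc.empties hc.accepts hc.tiles hpool _
      (fun i hi => Nat.add_sub_cancel' (hcap i hi).le) hfit (by omega) hcube hlow hhigh3
  obtain ⟨c, hcle, hbat⟩ := h.batches
  have hbat' : Batches (mergeParam n ^ 3) (st.regular (n - t)).buffers
      (st.regular (n - t)).poolStart (c + 1) := .append st.numSeg _ hbat hB
    fun i hi => ⟨Nat.sub_pos_of_lt (hcap i hi), (Nat.sub_le _ _).trans hpredK⟩
  have hpool' : ∀ k : Fin n, (st.regular (n - t)).poolStart ≤ k → st.cells k = none :=
    fun k hk => hpool k (by omega)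
  have hpoolsize : n - (st.regular (n - t)).poolStart + st.numSeg * prediction (n - t) st.numSeg
      = n - t := by omega
  have hc2 : c + 1 ≤ 2 * (st.phase + 1) := by omega
  have hc3 : c + 1 < 2 * (st.phase + 1) := by omega
  rw [State.newPhase_eq hc.empties (by rw [h.items]; exact hup') hcap hfit]
  split_ifs with ha hb
  · refine ⟨st.numSeg, ⟨hcore, h.failed, rfl, ⟨c + 1, hc2, hbat'⟩, fun _ => ⟨le_div_of_pool hB ?_,
      hpool', ?_⟩, ?_⟩, fun _ => capacity_ne_zero_of_core (st := st.regular (n - t)) hK hcore⟩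
    · dsimp only [State.regular] at ha hpoolsize ⊢
      omega
    · intro i _
      rw [segCount_self]
      exact Nat.zero_le _
    · intro hl
      exact absurd (hlast.symm.trans hl) (by simp)
  · exact ⟨st.numSeg, (inv_merge (st := st.regular (n - t)) hcore hK h.failed hlast rfl
      ⟨c + 1, hc3, hbat'⟩ hpool' hhigh hb).imp id fun h _ => h⟩
  · refine ⟨st.numSeg, ⟨hcore, h.failed, rfl, ⟨c + 1, hc2, hbat'⟩, ?_, fun _ => ⟨rfl, ?_⟩⟩, ?_⟩
    · intro hl
      cases hl
    · calc n - (st.regular (n - t)).poolStart ≤ st.numSeg * mergeParam n := (not_le.1 ha).le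
        _ ≤ mergeParam n * mergeParam n := Nat.mul_le_mul_right _ (not_lt.1 hb)
        _ = mergeParam n ^ 2 := by ring
    · intro hl
      cases hl

end NewPhase


/-! ### The run of the algorithm on a good stream -/

section Run

variable {n : ℕ} {x : Fin n → ℝ}

theorem initialSegments_bounds (hK : 10 ^ 12 ≤ mergeParam n) (hn : mergeParam n ≤ n) :
    0 < initialSegments n ∧ initialSegments n * mergeParam n ≤ n ∧
      n < initialSegments n * mergeParam n * mergeParam n := by
  have hK0 : 0 < mergeParam n := by omega
  have h1 : n / mergeParam n ≠ 0 := (Nat.div_pos hn hK0).ne'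
  have h2 := Nat.pow_log_le_self (mergeParam n) h1
  have h3 := Nat.lt_pow_succ_log_self (b := mergeParam n) (by omega) (n / mergeParam n)
  unfold initialSegments
  refine ⟨by positivity, (Nat.le_div_iff_mul_le hK0).1 h2, ?_⟩
  rw [pow_succ, Nat.div_lt_iff_lt_mul hK0] at h3
  exact h3

theorem inv_initialState (hK : 10 ^ 12 ≤ mergeParam n) (hn : mergeParam n ≤ n) :
    Inv x 0 (initialState n) 0 (initialSegments n) ∧
      ∀ i < (initialState n).numSeg, (initialState n).capacity i ≠ 0 := by
  obtain ⟨hB, h1, h2⟩ := initialSegments_bounds hK hn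
  have hK' : (1000000000000 : ℝ) ≤ mergeParam n := by exact_mod_cast hK
  have hB' : (0 : ℝ) < initialSegments n := by exact_mod_cast hB
  have hM : (mergeParam n : ℝ) ≤ (n : ℝ) / initialSegments n := by
    rw [le_div_iff₀ hB', mul_comm]
    exact_mod_cast h1
  have hM2 : (n : ℝ) / initialSegments n ≤ (mergeParam n : ℝ) ^ 2 := by
    rw [div_le_iff₀ hB']
    have : (n : ℝ) ≤ initialSegments n * mergeParam n * mergeParam n := by exact_mod_cast h2.le
    linarith
  have hM3 : (n : ℝ) / initialSegments n ≤ (mergeParam n : ℝ) ^ 3 :=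
    hM2.trans (pow_le_pow_right₀ (by linarith) (by norm_num))
  have hlow : (mergeParam n : ℝ) ^ (2 / 3 : ℝ) / 4 ≤ (n : ℝ) / initialSegments n := by
    have := rpow_two_thirds_le_self (μ := mergeParam n) (by linarith)
    linarith
  have hlarge := large_of_low hK hlow
  have hpred := mul_prediction_le hlarge
  have hpredK : prediction n (initialSegments n) ≤ mergeParam n ^ 3 := by
    have := (prediction_le_div hlarge).trans hM3
    exact_mod_cast this
  have hcore : Core x (fun _ => none) (([] : List Buffer) ++ allocate 0 (initialSegments n)
      fun _ => prediction n (initialSegments n))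
      (0 + ∑ _i ∈ Finset.range (initialSegments n), prediction n (initialSegments n))
      (initialSegments n) 1 0 0 (initialSegments n) := by
    refine core_allocate (Nat.zero_le n) hB ⟨_, rfl⟩ (by simp) (by simp) (by simp)
      List.Pairwise.nil (emptyCount_of_empty (by simp) (by simp)) (by simp) rfl (by simp) _
      (by simp) (by simpa using hpred) le_rfl (by simp) (by simpa using hlow) (by simpa using hM3)
  have hstart : (initialState n).poolStart
      = 0 + ∑ _i ∈ Finset.range (initialSegments n), prediction n (initialSegments n) := by
    simp [initialState]
  have hcore' : Core x (initialState n).cells (initialState n).buffers (initialState n).poolStart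
      (initialState n).numSeg (initialState n).phase 0 0 (initialSegments n) := by
    rw [hstart]
    exact hcore
  refine ⟨⟨hcore', rfl, rfl, ⟨1, by simp [initialState], ?_⟩,
    fun _ => ⟨hM, fun _ _ => rfl, ?_⟩, ?_⟩, capacity_ne_zero_of_core hK hcore'⟩
  · rw [hstart]
    exact Batches.append _ _ .nil hB
      fun _ _ => ⟨prediction_pos (by linarith), hpredK⟩
  · intro i _
    rw [segCount_self]
    exact Nat.zero_le _
  · intro hl
    cases hl

theorem inv_run (hg : Good x) (hK : 10 ^ 12 ≤ mergeParam n) (hn : mergeParam n ≤ n) {t : ℕ}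
    (ht : t ≤ n) : ∃ s F, Inv x t (run x t) s F ∧
      ((run x t).last = false → ∀ i < (run x t).numSeg, (run x t).capacity i ≠ 0) := by
  induction t with
  | zero =>
    obtain ⟨h1, h2⟩ := inv_initialState (x := x) hK hn
    exact ⟨0, _, h1, fun _ => h2⟩
  | succ t ih =>
    obtain ⟨s, F, hinv, hact⟩ := ih (by omega)
    have hlt : t < n := ht
    have hins := hinv.insertItem hg hK hlt hact
    rw [run, dif_pos hlt]
    unfold State.step
    dsimp only
    split_ifs with hc
    · obtain ⟨F', h1, h2⟩ := hins.newPhase hg hK hc.2.1 hc.2.2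
      exact ⟨t + 1, F', h1, h2⟩
    · refine ⟨s, F, hins, fun hl i hi h0 => hc ⟨hins.failed, hl, i, hi, h0⟩⟩

theorem inv_finalState (hg : Good x) (hK : 10 ^ 12 ≤ mergeParam n) (hn : mergeParam n ≤ n) :
    (∃ s F, Inv x n (finalState x) s F) ∧ (finalState x).last = true := by
  obtain ⟨s, F, hinv, hact⟩ := inv_run hg hK hn le_rfl
  refine ⟨⟨s, F, hinv⟩, ?_⟩
  by_contra hl
  rw [Bool.not_eq_true] at hl
  -- If the last phase had not begun, there would still be an empty cell.
  have h1 := hinv.core.sum_capAt_add_pool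
  have h2 := hact hl 0 hinv.core.hB
  have h3 := Finset.single_le_sum (f := fun i => capAt (run x n).cells (run x n).buffers
    (run x n).numSeg i) (fun _ _ => Nat.zero_le _) (Finset.mem_range.2 hinv.core.hB)
  have h4 : (finalState x).capacity 0 = 0 := by
    rw [State.capacity_eq]
    unfold finalState
    omega
  exact h2 h4

/-! ### The cost -/

theorem run_cells_cell (x : Fin n → ℝ) (s : Fin n) {t : ℕ} (hst : (s : ℕ) < t) (ht : t ≤ n) :
    (run x t).cells (cell x s) = some (x s) := by
  induction t with
  | zero => omega
  | succ t ih =>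
    have h := run_succ_cells x ⟨t, ht⟩
    dsimp only at h
    rw [h]
    by_cases hs : s = ⟨t, ht⟩
    · rw [hs, Function.update_self]
    · rw [Function.update_of_ne fun hc => hs (cell_injective x hc)]
      exact ih (by
        have : (s : ℕ) ≠ t := fun hc => hs (Fin.ext hc)
        omega) (by omega)

theorem finalState_cells (x : Fin n → ℝ) (k : Fin n) :
    (finalState x).cells k = some ((adaptMerge n).array x k) := by
  have h : cell x (((adaptMerge n).place x).symm k) = k :=
    ((adaptMerge n).place x).apply_symm_apply k
  have := run_cells_cell x (((adaptMerge n).place x).symm k) (Fin.is_lt _) le_rfl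
  rw [h] at this
  exact this

/-- The difference between the contents of the cell `k` and of the next cell. -/
noncomputable def gap (A : Fin n → ℝ) (k : ℕ) : ℝ :=
  if h : k + 1 < n then |A ⟨k + 1, h⟩ - A ⟨k, Nat.lt_of_succ_lt h⟩| else 0

theorem adjacentCost_eq (A : Fin n → ℝ) : adjacentCost A = ∑ k ∈ Finset.range n, gap A k := by
  rw [Finset.sum_range]
  rfl

theorem gap_le_one {A : Fin n → ℝ} (hA : ∀ k, A k ∈ Set.Icc (0 : ℝ) 1) (k : ℕ) : gap A k ≤ 1 := by
  unfold gap
  split_ifs with h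
  · have h1 := hA ⟨k + 1, h⟩
    have h2 := hA ⟨k, Nat.lt_of_succ_lt h⟩
    rw [abs_le]
    constructor <;> linarith [h1.1, h1.2, h2.1, h2.2]
  · exact zero_le_one

theorem Tiles.exists_covers {l : List Buffer} {a c k : ℕ} (h : Tiles l a c) (h1 : a ≤ k)
    (h2 : k < c) : ∃ b ∈ l, b.Covers k := by
  induction l generalizing a with
  | nil =>
    have : a = c := h
    omega
  | cons b l ih =>
    rcases lt_or_ge k (a + b.size) with h3 | h3
    · exact ⟨b, List.mem_cons_self, by unfold Buffer.Covers; rw [h.1]; exact ⟨h1, h3⟩⟩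
    · obtain ⟨b', hb', hc⟩ := ih h.2 h3
      exact ⟨b', List.mem_cons_of_mem _ hb', hc⟩

theorem abs_sub_le_of_segmentOf {B i : ℕ} (hB : 0 < B) {y z : ℝ} (hy : y ∈ Set.Icc (0 : ℝ) 1)
    (hz : z ∈ Set.Icc (0 : ℝ) 1) (hyi : segmentOf B y = i)
    (hzi : segmentOf B z = i ∨ segmentOf B z = i + 1) : |z - y| ≤ 2 / B := by
  have hB' : (0 : ℝ) < B := by exact_mod_cast hB
  obtain ⟨h1, h2⟩ := segmentOf_bounds hB hy
  obtain ⟨h3, h4⟩ := segmentOf_bounds hB hz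
  rw [hyi] at h1 h2
  rw [abs_le, ← neg_div, div_le_iff₀ hB', le_div_iff₀ hB']
  rw [div_le_iff₀ hB'] at h1 h3
  rw [le_div_iff₀ hB'] at h2 h4
  rcases hzi with hzi | hzi <;> rw [hzi] at h3 h4 <;> push_cast at h3 h4 <;>
    constructor <;> linarith

/-- Inside the cells of one allocation, all steps but the last are short. -/
theorem gap_allocate_le {A : Fin n → ℝ} (hA : ∀ k, A k ∈ Set.Icc (0 : ℝ) 1) {a B : ℕ}
    {size : ℕ → ℕ} (hB : 0 < B) (hs : ∀ i < B, 0 < size i)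
    (hacc : ∀ b ∈ allocate a B size, ∀ k : Fin n, b.Covers k → b.Accepts (A k)) {k : ℕ}
    (hak : a ≤ k) (hk : k + 1 < a + ∑ i ∈ Finset.range B, size i) : gap A k ≤ 2 / B := by
  unfold gap
  split_ifs with hn
  · obtain ⟨b, hb, hbk⟩ := (tiles_allocate a B size).exists_covers hak (by omega)
    have hy := hacc b hb ⟨k, Nat.lt_of_succ_lt hn⟩ hbk
    obtain ⟨i, hi, rfl⟩ := mem_allocate.1 hb
    refine abs_sub_le_of_segmentOf hB (hA _) (hA _) (i := i) hy ?_
    unfold Buffer.Covers at hbk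
    dsimp only at hbk
    rcases Nat.lt_or_ge (k + 1) (a + ∑ j ∈ Finset.range i, size j + size i) with h1 | h1
    · exact Or.inl (hacc _ hb ⟨k + 1, hn⟩ ⟨by dsimp only; omega, h1⟩)
    · have hsum := Finset.sum_range_succ size i
      have hi1 : i + 1 < B := by
        by_contra hcon
        obtain rfl : B = i + 1 := by omega
        omega
      refine Or.inr (hacc _ (mem_allocate.2 ⟨i + 1, hi1, rfl⟩) ⟨k + 1, hn⟩ ?_)
      have := hs (i + 1) hi1
      exact ⟨by dsimp only; omega, by dsimp only; omega⟩
  · positivity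

/-- One allocation contributes `O(S)` to the cost: each of its at most `B * S` steps has length at
most `2 / B`, except for the step to the next allocation. -/
theorem sum_gap_allocate_le {A : Fin n → ℝ} (hA : ∀ k, A k ∈ Set.Icc (0 : ℝ) 1) {a B S : ℕ}
    {size : ℕ → ℕ} (hB : 0 < B) (hs : ∀ i < B, 0 < size i ∧ size i ≤ S)
    (hacc : ∀ b ∈ allocate a B size, ∀ k : Fin n, b.Covers k → b.Accepts (A k)) :
    ∑ k ∈ Finset.Ico a (a + ∑ i ∈ Finset.range B, size i), gap A k ≤ 2 * S + 1 := by
  have hB' : (0 : ℝ) < B := by exact_mod_cast hB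
  have hpos : 0 < ∑ i ∈ Finset.range B, size i :=
    Finset.sum_pos (fun i hi => (hs i (Finset.mem_range.1 hi)).1)
      (Finset.nonempty_range_iff.2 hB.ne')
  have hle : ∑ i ∈ Finset.range B, size i ≤ B * S := by
    calc _ ≤ ∑ _i ∈ Finset.range B, S :=
          Finset.sum_le_sum fun i hi => (hs i (Finset.mem_range.1 hi)).2
      _ = _ := by rw [Finset.sum_const, Finset.card_range, smul_eq_mul]
  obtain ⟨m, hm⟩ : ∃ m, ∑ i ∈ Finset.range B, size i = m + 1 := ⟨_, (Nat.succ_pred hpos.ne').symm⟩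
  have hshort : ∀ k ∈ Finset.Ico a (a + m), gap A k ≤ 2 / B := by
    intro k hk
    rw [Finset.mem_Ico] at hk
    exact gap_allocate_le hA hB (fun i hi => (hs i hi).1) hacc hk.1 (by omega)
  rw [hm, ← add_assoc, Finset.sum_Ico_succ_top (Nat.le_add_right _ _)]
  have h1 := Finset.sum_le_card_nsmul _ _ _ hshort
  rw [Nat.card_Ico, Nat.add_sub_cancel_left, nsmul_eq_mul] at h1
  have h2 : (m : ℝ) * (2 / B) ≤ 2 * S := by
    have h3 : (m : ℝ) ≤ B * S := by exact_mod_cast (by omega : m ≤ B * S)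
    calc (m : ℝ) * (2 / B) ≤ (B * S) * (2 / B) := by gcongr
      _ = _ := by field_simp
  linarith [gap_le_one hA (a + m)]

theorem Batches.sum_gap_le {A : Fin n → ℝ} (hA : ∀ k, A k ∈ Set.Icc (0 : ℝ) 1) {S : ℕ}
    {l : List Buffer} {a c : ℕ} (h : Batches S l a c)
    (hacc : ∀ b ∈ l, ∀ k : Fin n, b.Covers k → b.Accepts (A k)) :
    ∑ k ∈ Finset.range a, gap A k ≤ c * (2 * S + 1) := by
  induction h with
  | nil => simp
  | @append l a c B size _ hB hs ih =>
    have h1 := ih fun b hb => hacc b (List.mem_append_left _ hb)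
    have h2 := sum_gap_allocate_le hA hB hs fun b hb => hacc b (List.mem_append_right _ hb)
    rw [← Finset.sum_range_add_sum_Ico _ (Nat.le_add_right a _)]
    push_cast
    linarith

theorem cost_le (hg : Good x) (hK : 10 ^ 12 ≤ mergeParam n) (hn : mergeParam n ≤ n) :
    (adaptMerge n).cost x
      ≤ 2 * (finalState x).phase * (2 * (mergeParam n : ℝ) ^ 3 + 1) + (mergeParam n : ℝ) ^ 2 := by
  obtain ⟨⟨s, F, hinv⟩, hlast⟩ := inv_finalState hg hK hn
  obtain ⟨c, hc, hbat⟩ := hinv.batches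
  have hA : ∀ k, (adaptMerge n).array x k ∈ Set.Icc (0 : ℝ) 1 := fun k => hg.mem _
  have h1 := hbat.sum_gap_le hA fun b hb k hbk =>
    hinv.core.accepts b hb k _ hbk (finalState_cells x k)
  have h2 : ∑ k ∈ Finset.Ico (finalState x).poolStart n, gap ((adaptMerge n).array x) k
      ≤ (mergeParam n : ℝ) ^ 2 := by
    have h3 := Finset.sum_le_card_nsmul (Finset.Ico (finalState x).poolStart n) _ _
      fun k _ => gap_le_one hA k
    rw [Nat.card_Ico, nsmul_eq_mul, mul_one] at h3
    exact h3.trans (by exact_mod_cast (hinv.final hlast).2)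
  unfold Algorithm.cost
  rw [adjacentCost_eq, ← Finset.sum_range_add_sum_Ico _ hinv.core.hp]
  have h4 : (c : ℝ) ≤ 2 * (finalState x).phase := by exact_mod_cast hc
  push_cast at h1
  have h5 : (c : ℝ) * (2 * (mergeParam n : ℝ) ^ 3 + 1)
      ≤ 2 * (finalState x).phase * (2 * (mergeParam n : ℝ) ^ 3 + 1) := by gcongr
  linarith

end Run


open MeasureTheory

/-! ### Concentration of the item counts -/

section Probability

instance isProbabilityMeasure_unit :
    IsProbabilityMeasure (volume.restrict (Set.Icc (0 : ℝ) 1)) :=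
  ⟨by simp⟩

instance isProbabilityMeasure_streamLaw (n : ℕ) : IsProbabilityMeasure (streamLaw n) := by
  unfold streamLaw
  infer_instance

theorem measurable_segmentOf (B : ℕ) : Measurable (segmentOf B) := by
  unfold segmentOf
  exact (Nat.measurable_floor.comp (measurable_id.mul_const _)).min measurable_const

theorem measurableSet_segment (B i : ℕ) : MeasurableSet {y : ℝ | segmentOf B y = i} :=
  measurable_segmentOf B (measurableSet_singleton i)

/-- An item falls into each of the `B` segments with probability `1 / B`. -/
theorem measureReal_segment {B i : ℕ} (hi : i < B) :
    (volume.restrict (Set.Icc (0 : ℝ) 1)).real {y : ℝ | segmentOf B y = i} = 1 / B := by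
  have hB : (0 : ℝ) < B := by exact_mod_cast (Nat.zero_le i).trans_lt hi
  have hi' : (i : ℝ) + 1 ≤ B := by exact_mod_cast hi
  rw [measureReal_restrict_apply (measurableSet_segment B i)]
  have hsub1 : Set.Ico ((i : ℝ) / B) ((i + 1) / B) ⊆
      {y : ℝ | segmentOf B y = i} ∩ Set.Icc (0 : ℝ) 1 := by
    intro y hy
    have h1 := (div_le_iff₀ hB).1 hy.1
    have h2 := (lt_div_iff₀ hB).1 hy.2
    have hi0 : (0 : ℝ) ≤ i := Nat.cast_nonneg i
    refine ⟨?_, le_trans (by positivity) hy.1, hy.2.le.trans ((div_le_one hB).2 hi')⟩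
    have h3 : ⌊y * B⌋₊ = i := (Nat.floor_eq_iff (hi0.trans h1)).2 ⟨h1, h2⟩
    change min ⌊y * B⌋₊ (B - 1) = i
    rw [h3]
    omega
  have hsub2 : {y : ℝ | segmentOf B y = i} ∩ Set.Icc (0 : ℝ) 1 ⊆
      Set.Icc ((i : ℝ) / B) ((i + 1) / B) := by
    rintro y ⟨hy, hy'⟩
    have := segmentOf_bounds (B := B) (by omega) hy'
    rw [show segmentOf B y = i from hy] at this
    exact this
  have hlen : ((i : ℝ) + 1) / B - i / B = 1 / B := by ring
  have hle : (i : ℝ) / B ≤ (i + 1) / B := by gcongr; linarith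
  refine le_antisymm ?_ ?_
  · refine (measureReal_mono hsub2 (by simp)).trans ?_
    rw [Real.volume_real_Icc_of_le hle, hlen]
  · refine le_trans ?_ (measureReal_mono hsub1 ?_)
    · rw [Real.volume_real_Ico_of_le hle, hlen]
    · exact ((measure_mono Set.inter_subset_right).trans_lt (by simp)).ne

/-- The moment generating function of one indicator. -/
theorem integral_exp_indicator_le {B i : ℕ} (hi : i < B) (θ : ℝ) :
    ∫ y, Real.exp (θ * if segmentOf B y = i then 1 else 0) ∂(volume.restrict (Set.Icc (0 : ℝ) 1))
      ≤ Real.exp ((Real.exp θ - 1) / B) := by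
  have h1 : (fun y : ℝ => Real.exp (θ * if segmentOf B y = i then 1 else 0))
      = fun y => 1 + {y : ℝ | segmentOf B y = i}.indicator (fun _ => Real.exp θ - 1) y := by
    funext y
    by_cases h : segmentOf B y = i
    · rw [if_pos h, Set.indicator_of_mem (by exact h)]
      simp
    · rw [if_neg h, Set.indicator_of_notMem (by exact h)]
      simp
  rw [h1, integral_add (integrable_const _)
    ((integrable_const _).indicator (measurableSet_segment B i)),
    integral_indicator_const _ (measurableSet_segment B i), measureReal_segment hi]
  simp only [integral_const, probReal_univ, smul_eq_mul, mul_one]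
  have := Real.add_one_le_exp ((Real.exp θ - 1) / B)
  calc 1 + 1 / (B : ℝ) * (Real.exp θ - 1) = (Real.exp θ - 1) / B + 1 := by ring
    _ ≤ _ := this

variable {n : ℕ}

theorem measurable_segCount (s t B i : ℕ) :
    Measurable fun x : Fin n → ℝ => (segCount x s t B i : ℝ) := by
  simp only [segCount_eq_sum, Nat.cast_sum, Nat.cast_ite, Nat.cast_one, Nat.cast_zero]
  refine Finset.measurable_sum _ fun r _ => Measurable.ite ?_ measurable_const measurable_const
  have h : MeasurableSet ((fun x : Fin n → ℝ => x r) ⁻¹' {y : ℝ | segmentOf B y = i}) :=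
    measurable_pi_apply r (measurableSet_segment B i)
  exact h

theorem segCount_le (x : Fin n → ℝ) (s t B i : ℕ) : segCount x s t B i ≤ n := by
  refine (Finset.card_filter_le _ _).trans ?_
  simp

theorem integrable_exp_segCount (s t B i : ℕ) (θ : ℝ) :
    Integrable (fun x : Fin n → ℝ => Real.exp (θ * segCount x s t B i)) (streamLaw n) := by
  refine Integrable.of_bound
    ((measurable_segCount s t B i).const_mul θ).exp.aestronglyMeasurable (Real.exp (|θ| * n))
    (Filter.Eventually.of_forall fun x => ?_)
  rw [Real.norm_eq_abs, Real.abs_exp, Real.exp_le_exp]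
  have h1 : (segCount x s t B i : ℝ) ≤ n := by exact_mod_cast segCount_le x s t B i
  calc θ * segCount x s t B i ≤ |θ| * segCount x s t B i := by
        gcongr
        exact le_abs_self θ
    _ ≤ |θ| * n := by gcongr

theorem mgf_segCount_le {s t B i : ℕ} (ht : t ≤ n) (hi : i < B) (θ : ℝ) :
    ProbabilityTheory.mgf (fun x : Fin n → ℝ => (segCount x s t B i : ℝ)) (streamLaw n) θ
      ≤ Real.exp (((t - s : ℕ) : ℝ) / B * (Real.exp θ - 1)) := by
  classical
  let W : Finset (Fin n) := Finset.univ.filter fun r : Fin n => s ≤ (r : ℕ) ∧ (r : ℕ) < t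
  have hW : W.card = t - s := by
    have h := sum_segCount (fun _ : Fin n => (0 : ℝ)) (s := s) (B := 1) Nat.one_pos ht
    rw [Finset.sum_range_one, segCount_eq_sum] at h
    rw [← h, Finset.card_eq_sum_ones]
    refine Finset.sum_congr rfl fun r _ => ?_
    simp [segmentOf]
  have h1 : ∀ x : Fin n → ℝ, Real.exp (θ * segCount x s t B i)
      = ∏ r, if r ∈ W then Real.exp (θ * if segmentOf B (x r) = i then 1 else 0) else 1 := by
    intro x
    rw [Finset.prod_ite_mem, Finset.univ_inter, ← Real.exp_sum, ← Finset.mul_sum,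
      segCount_eq_sum]
    push_cast
    rfl
  unfold ProbabilityTheory.mgf
  simp only [h1]
  unfold streamLaw
  rw [integral_fintype_prod_eq_prod (𝕜 := ℝ) (f := fun (r : Fin n) (y : ℝ) =>
    if r ∈ W then Real.exp (θ * if segmentOf B y = i then 1 else 0) else 1)]
  have h2 : ∀ r : Fin n, ∫ y, (if r ∈ W then
        Real.exp (θ * if segmentOf B y = i then 1 else 0) else 1)
        ∂(volume.restrict (Set.Icc (0 : ℝ) 1))
      ≤ if r ∈ W then Real.exp ((Real.exp θ - 1) / B) else 1 := by
    intro r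
    by_cases hr : r ∈ W
    · simp only [if_pos hr]
      exact integral_exp_indicator_le hi θ
    · simp [hr]
  refine (Finset.prod_le_prod (fun r _ => integral_nonneg fun y => ?_) fun r _ => h2 r).trans ?_
  · dsimp only [Pi.zero_apply]
    split_ifs <;> positivity
  · rw [Finset.prod_ite_mem, Finset.univ_inter, Finset.prod_const, hW, ← Real.exp_nat_mul]
    refine le_of_eq ?_
    congr 1
    ring

/-- A Bernstein type bound for the number of items of one segment in one period. -/
theorem streamLaw_deviation_le {s t B i : ℕ} (ht : t ≤ n) (hi : i < B) {M : ℝ}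
    (hM : 1 ≤ M) (hMt : ((t - s : ℕ) : ℝ) / B ≤ M) :
    (streamLaw n).real {x | M ^ (2 / 3 : ℝ) / 20
        < |(segCount x s t B i : ℝ) - ((t - s : ℕ) : ℝ) / B|}
      ≤ 2 * Real.exp (-(M ^ (1 / 3 : ℝ) / 1600)) := by
  obtain ⟨a, ha, rfl⟩ : ∃ a : ℝ, 0 ≤ a ∧ a ^ 3 = M := by
    refine ⟨M ^ (1 / 3 : ℝ), Real.rpow_nonneg (by linarith) _, ?_⟩
    rw [← Real.rpow_natCast, ← Real.rpow_mul (by linarith)]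
    norm_num
  have ha1 : 1 ≤ a := by
    by_contra hc
    push Not at hc
    have := pow_lt_one₀ ha hc (n := 3) (by norm_num)
    linarith
  have ha0 : 0 < a := by linarith
  have hcube : (a ^ 3) ^ (1 / 3 : ℝ) = a := by
    rw [← Real.rpow_natCast, ← Real.rpow_mul ha]
    norm_num
  rw [rpow_two_thirds_cube ha, hcube]
  set ν : ℝ := ((t - s : ℕ) : ℝ) / B with hν
  have hν0 : 0 ≤ ν := by positivity
  -- The optimal exponent is the deviation divided by twice the bound on the variance.
  set θ : ℝ := 1 / (40 * a) with hθ
  have hθ0 : 0 < θ := by positivity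
  have hθ1 : θ ≤ 1 := by
    rw [hθ, div_le_one (by positivity)]
    linarith
  have hθa : θ * a = 1 / 40 := by
    rw [hθ]
    field_simp
  have hbound : ∀ η : ℝ, |η| = θ → Real.exp (-(η * ν + θ * (a ^ 2 / 20))) *
      ProbabilityTheory.mgf (fun x : Fin n → ℝ => (segCount x s t B i : ℝ)) (streamLaw n) η
        ≤ Real.exp (-(a / 1600)) := by
    intro η hη
    have h1 := (abs_le.1 (Real.abs_exp_sub_one_sub_id_le (hη.le.trans hθ1))).2
    have h2 : η ^ 2 = θ ^ 2 := by rw [← sq_abs, hη]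
    have h3 : ν * (Real.exp η - 1) ≤ ν * η + a ^ 3 * θ ^ 2 := by
      have h4 : ν * (Real.exp η - 1 - η) ≤ ν * η ^ 2 := by gcongr
      have h5 : ν * η ^ 2 ≤ a ^ 3 * θ ^ 2 := by
        rw [h2]
        gcongr
      linarith
    calc _ ≤ Real.exp (-(η * ν + θ * (a ^ 2 / 20))) * Real.exp (ν * (Real.exp η - 1)) := by
          gcongr
          exact mgf_segCount_le ht hi η
      _ = Real.exp (-(η * ν + θ * (a ^ 2 / 20)) + ν * (Real.exp η - 1)) := (Real.exp_add _ _).symm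
      _ ≤ _ := by
        rw [Real.exp_le_exp]
        have h6 : a ^ 3 * θ ^ 2 = a / 1600 := by
          calc a ^ 3 * θ ^ 2 = a * (θ * a) ^ 2 := by ring
            _ = _ := by rw [hθa]; ring
        have h7 : θ * (a ^ 2 / 20) = a / 800 := by
          calc θ * (a ^ 2 / 20) = a * (θ * a) / 20 := by ring
            _ = _ := by rw [hθa]; ring
        linarith
  have hup := ProbabilityTheory.measure_ge_le_exp_mul_mgf (μ := streamLaw n)
    (X := fun x => (segCount x s t B i : ℝ)) (ν + a ^ 2 / 20) hθ0.le
    (integrable_exp_segCount s t B i θ)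
  have hlo := ProbabilityTheory.measure_le_le_exp_mul_mgf (μ := streamLaw n)
    (X := fun x => (segCount x s t B i : ℝ)) (t := -θ) (ν - a ^ 2 / 20) (by linarith)
    (integrable_exp_segCount s t B i (-θ))
  have hup' := hup.trans (le_of_eq_of_le (by congr 2; ring) (hbound θ (abs_of_pos hθ0)))
  have hlo' := hlo.trans (le_of_eq_of_le (by congr 2; ring)
    (hbound (-θ) (by rw [abs_neg, abs_of_pos hθ0])))
  calc _ ≤ (streamLaw n).real ({x | ν + a ^ 2 / 20 ≤ (segCount x s t B i : ℝ)}
        ∪ {x | (segCount x s t B i : ℝ) ≤ ν - a ^ 2 / 20}) := by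
        refine measureReal_mono fun x hx => ?_
        have hx' : a ^ 2 / 20 < |(segCount x s t B i : ℝ) - ν| := hx
        rcases lt_abs.1 hx' with h | h
        · exact Or.inl (by simp only [Set.mem_ofPred_eq]; linarith)
        · exact Or.inr (by simp only [Set.mem_ofPred_eq]; linarith)
    _ ≤ _ := measureReal_union_le _ _
    _ ≤ _ := by linarith

theorem streamLaw_not_mem (n : ℕ) :
    streamLaw n {x | ¬ ∀ r, x r ∈ Set.Icc (0 : ℝ) 1} = 0 := by
  have h : ∀ r : Fin n, ∀ᵐ x ∂(streamLaw n), x r ∈ Set.Icc (0 : ℝ) 1 := by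
    intro r
    unfold streamLaw
    exact (Measure.tendsto_eval_ae_ae (μ := fun _ : Fin n => volume.restrict (Set.Icc (0 : ℝ) 1))
      (i := r)).eventually (ae_restrict_mem measurableSet_Icc)
  exact ae_all_iff.2 h

/-- A stream is good with high probability, by a union bound over all segments and all periods.
Since the bound covers all periods at once, the dependence of the phases on the stream is
irrelevant. -/
theorem streamLaw_not_good_le (hK : 10 ^ 12 ≤ mergeParam n) :
    streamLaw n {x | ¬ Good x} ≤ ENNReal.ofReal ((n + 1 : ℝ) ^ 4 *
      (2 * Real.exp (-(((mergeParam n : ℝ) ^ (2 / 3 : ℝ) / 4) ^ (1 / 3 : ℝ) / 1600)))) := by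
  classical
  set M₀ : ℝ := (mergeParam n : ℝ) ^ (2 / 3 : ℝ) / 4 with hM₀
  have hlarge : 1000000 ≤ M₀ := large_of_low hK le_rfl
  let dev : ℕ × ℕ × ℕ × ℕ → Set (Fin n → ℝ) := fun q =>
    {x | q.2.1 < q.1 ∧ q.2.2.1 ≤ q.2.2.2 ∧ q.2.2.2 ≤ n ∧ M₀ ≤ ((n - q.2.2.1 : ℕ) : ℝ) / q.1 ∧
      (((n - q.2.2.1 : ℕ) : ℝ) / q.1) ^ (2 / 3 : ℝ) / 20
        < |(segCount x q.2.2.1 q.2.2.2 q.1 q.2.1 : ℝ) - ((q.2.2.2 - q.2.2.1 : ℕ) : ℝ) / q.1|}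
  let R := Finset.range (n + 1)
  let Q : Finset (ℕ × ℕ × ℕ × ℕ) := R ×ˢ R ×ˢ R ×ˢ R
  have hsub : {x | ¬ Good x}
      ⊆ {x : Fin n → ℝ | ¬ ∀ r, x r ∈ Set.Icc (0 : ℝ) 1} ∪ ⋃ q ∈ Q, dev q := by
    intro x hx
    by_contra hcon
    rw [Set.mem_union, not_or, Set.mem_iUnion₂, not_exists] at hcon
    refine hx ⟨not_not.1 hcon.1, fun B i s t hi hst ht hM => ?_⟩
    by_contra hdev
    have hB : B ≤ n := by
      have hB0 : (0 : ℝ) < B := by exact_mod_cast (Nat.zero_le i).trans_lt hi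
      have h1 : 1 ≤ ((n - s : ℕ) : ℝ) / B := by linarith
      rw [one_le_div hB0] at h1
      have h2 : B ≤ n - s := by exact_mod_cast h1
      omega
    refine hcon.2 (B, i, s, t) ⟨?_, hi, hst, ht, hM, not_le.1 hdev⟩
    simp only [Q, R, Finset.mem_product, Finset.mem_range]
    omega
  have hdev : ∀ q, streamLaw n (dev q)
      ≤ ENNReal.ofReal (2 * Real.exp (-(M₀ ^ (1 / 3 : ℝ) / 1600))) := by
    rintro ⟨B, i, s, t⟩
    by_cases hq : i < B ∧ s ≤ t ∧ t ≤ n ∧ M₀ ≤ ((n - s : ℕ) : ℝ) / B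
    · obtain ⟨hi, hst, ht, hM⟩ := hq
      have h1 := streamLaw_deviation_le (s := s) ht hi (M := ((n - s : ℕ) : ℝ) / B) (by linarith)
        (by gcongr)
      have h2 : Real.exp (-((((n - s : ℕ) : ℝ) / B) ^ (1 / 3 : ℝ) / 1600))
          ≤ Real.exp (-(M₀ ^ (1 / 3 : ℝ) / 1600)) := by
        rw [Real.exp_le_exp]
        gcongr
      refine (measure_mono (t := {x | (((n - s : ℕ) : ℝ) / B) ^ (2 / 3 : ℝ) / 20
        < |(segCount x s t B i : ℝ) - ((t - s : ℕ) : ℝ) / B|}) fun x hx => hx.2.2.2.2).trans ?_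
      rw [← ofReal_measureReal]
      exact ENNReal.ofReal_le_ofReal (by linarith)
    · have : dev (B, i, s, t) = ∅ :=
        Set.eq_empty_of_forall_notMem fun x hx => hq ⟨hx.1, hx.2.1, hx.2.2.1, hx.2.2.2.1⟩
      rw [this, measure_empty]
      exact zero_le
  calc streamLaw n {x | ¬ Good x}
      ≤ streamLaw n {x : Fin n → ℝ | ¬ ∀ r, x r ∈ Set.Icc (0 : ℝ) 1}
        + streamLaw n (⋃ q ∈ Q, dev q) := (measure_mono hsub).trans (measure_union_le _ _)
    _ ≤ ∑ q ∈ Q, streamLaw n (dev q) := by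
      rw [streamLaw_not_mem, zero_add]
      exact measure_biUnion_finset_le _ _
    _ ≤ Q.card • ENNReal.ofReal (2 * Real.exp (-(M₀ ^ (1 / 3 : ℝ) / 1600))) :=
      Finset.sum_le_card_nsmul _ _ _ fun q _ => hdev q
    _ = _ := by
      rw [nsmul_eq_mul, ← ENNReal.ofReal_natCast, ← ENNReal.ofReal_mul (Nat.cast_nonneg _)]
      congr 2
      simp only [Q, R, Finset.card_product, Finset.card_range]
      push_cast
      ring

end Probability


open Filter

/-! ### The bounds in terms of `log n` -/

section Asymptotics

variable {n : ℕ} {x : Fin n → ℝ}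

theorem log_pow_le_mergeParam (n : ℕ) : Real.log n ^ 8 ≤ mergeParam n := Nat.le_ceil _

theorem mergeParam_le (h : 1 ≤ Real.log n) : (mergeParam n : ℝ) ≤ 2 * Real.log n ^ 8 := by
  have h1 : (mergeParam n : ℝ) < Real.log n ^ 8 + 1 := Nat.ceil_lt_add_one (by positivity)
  have h2 := one_le_pow₀ h (n := 8)
  linarith

theorem phase_le (hg : Good x) (hK : 10 ^ 12 ≤ mergeParam n) (hn : mergeParam n ≤ n)
    (hL : Real.exp 1 ≤ Real.log n) :
    ((finalState x).phase : ℝ) ≤ 2 * (Real.log n / Real.log (Real.log n)) := by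
  obtain ⟨⟨s, F, hinv⟩, -⟩ := inv_finalState hg hK hn
  have hL0 : 0 < Real.log n := (Real.exp_pos 1).trans_le hL
  have hLL : 1 ≤ Real.log (Real.log n) := by rwa [Real.le_log_iff_exp_le hL0]
  have hLL' : Real.log (Real.log n) ≤ Real.log n - 1 := Real.log_le_sub_one_of_pos hL0
  have hn0 : (0 : ℝ) < n := by
    have : 0 < n := by omega
    exact_mod_cast this
  have hK0 : (0 : ℝ) < mergeParam n := by
    have : 0 < mergeParam n := by omega
    exact_mod_cast this
  have hpos : 1 ≤ n - s := by
    have h1 := large_of_low hK hinv.core.low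
    by_contra hc
    rw [show n - s = 0 by omega] at h1
    norm_num at h1
  have hcube := hinv.core.cube
  have h1 : mergeParam n ^ (finalState x).phase ≤ n ^ 3 * mergeParam n :=
    (Nat.le_mul_of_pos_left _ (by positivity)).trans hcube
  have h2 : (mergeParam n : ℝ) ^ (finalState x).phase ≤ (n : ℝ) ^ 3 * mergeParam n := by
    exact_mod_cast h1
  have h3 := Real.log_le_log (by positivity) h2
  rw [Real.log_pow, Real.log_mul (by positivity) hK0.ne', Real.log_pow] at h3
  have h4 : 8 * Real.log (Real.log n) ≤ Real.log (mergeParam n) := by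
    have := Real.log_le_log (by positivity) (log_pow_le_mergeParam n)
    rw [Real.log_pow] at this
    exact_mod_cast this
  have h5 : (1 : ℝ) ≤ (finalState x).phase := by exact_mod_cast hinv.core.hph
  push_cast at h3
  rw [← mul_div_assoc, le_div_iff₀ (by linarith)]
  have h6 : ((finalState x).phase - 1 : ℝ) * (8 * Real.log (Real.log n)) ≤ 3 * Real.log n := by
    calc _ ≤ ((finalState x).phase - 1 : ℝ) * Real.log (mergeParam n) :=
          mul_le_mul_of_nonneg_left h4 (by linarith)
      _ ≤ _ := by linarith
  linarith

/-- The conclusions about a single stream. -/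
theorem bounds_of_good (hg : Good x) (hK : 10 ^ 12 ≤ mergeParam n) (hn : mergeParam n ≤ n)
    (hL : Real.exp 1 ≤ Real.log n) {C : ℝ} (hC : 100 ≤ C) :
    (adaptMerge n).cost x ≤ C * Real.log n ^ 25 ∧ (finalState x).failed = false ∧
      (finalState x).last = true ∧
      (∀ b ∈ (finalState x).buffers, (b.size : ℝ) ≤ C * Real.log n ^ 25) ∧
      ((finalState x).poolSize : ℝ) ≤ C * Real.log n ^ 25 ∧
      ((finalState x).phase : ℝ) ≤ C * (Real.log n / Real.log (Real.log n)) := by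
  obtain ⟨⟨s, F, hinv⟩, hlast⟩ := inv_finalState hg hK hn
  obtain ⟨c, -, hbat⟩ := hinv.batches
  have hphase := phase_le hg hK hn hL
  have hcost := cost_le hg hK hn
  have hL1 : 1 ≤ Real.log n := le_trans (by have := Real.add_one_le_exp (1 : ℝ); linarith) hL
  have hLL : 1 ≤ Real.log (Real.log n) := by rwa [Real.le_log_iff_exp_le (by linarith)]
  have hKL := mergeParam_le hL1
  set L : ℝ := Real.log n with hLdef
  have hdiv0 : 0 ≤ L / Real.log L := by positivity
  have hdiv : L / Real.log L ≤ L := div_le_self (by linarith) hLL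
  have hK3 : (mergeParam n : ℝ) ^ 3 ≤ 8 * L ^ 24 := by
    calc (mergeParam n : ℝ) ^ 3 ≤ (2 * L ^ 8) ^ 3 := by gcongr
      _ = _ := by ring
  have hK2 : (mergeParam n : ℝ) ^ 2 ≤ 4 * L ^ 16 := by
    calc (mergeParam n : ℝ) ^ 2 ≤ (2 * L ^ 8) ^ 2 := by gcongr
      _ = _ := by ring
  have hpow : ∀ m ≤ 25, L ^ m ≤ L ^ 25 := fun m hm => pow_le_pow_right₀ hL1 hm
  have hpos : 0 < L ^ 25 := by positivity
  have hC25 : 100 * L ^ 25 ≤ C * L ^ 25 := by gcongr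
  refine ⟨?_, hinv.failed, hlast, fun b hb => ?_, ?_, ?_⟩
  · have h1 : 2 * ((finalState x).phase : ℝ) * (2 * (mergeParam n : ℝ) ^ 3 + 1)
        ≤ 2 * (2 * L) * (2 * (8 * L ^ 24) + 1) := by
      gcongr
      linarith
    have h2 : 2 * (2 * L) * (2 * (8 * L ^ 24) + 1) = 64 * L ^ 25 + 4 * L ^ 1 := by ring
    linarith [hpow 1 (by norm_num), hpow 16 (by norm_num)]
  · have h1 : (b.size : ℝ) ≤ (mergeParam n : ℝ) ^ 3 := by exact_mod_cast hbat.size_le b hb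
    linarith [hpow 24 (by norm_num)]
  · have h1 : ((finalState x).poolSize : ℝ) ≤ (mergeParam n : ℝ) ^ 2 := by
      exact_mod_cast (hinv.final hlast).2
    linarith [hpow 16 (by norm_num)]
  · calc _ ≤ 2 * (L / Real.log L) := hphase
      _ ≤ _ := by gcongr; linarith

theorem eventually_large : ∀ᶠ n : ℕ in atTop, 10 ^ 12 ≤ mergeParam n ∧ mergeParam n ≤ n ∧
    Real.exp 1 ≤ Real.log n ∧
    15 * Real.log n ≤ ((mergeParam n : ℝ) ^ (2 / 3 : ℝ) / 4) ^ (1 / 3 : ℝ) / 1600 := by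
  have hlog : Tendsto (fun n : ℕ => Real.log n) atTop atTop :=
    Real.tendsto_log_atTop.comp tendsto_natCast_atTop_atTop
  have h1 : ∀ᶠ n : ℕ in atTop, (10 : ℝ) ^ 8 ≤ Real.log n := hlog.eventually_ge_atTop _
  have h2 : ∀ᶠ n : ℕ in atTop, Real.log n ^ 8 ≤ (n : ℝ) := by
    have h := (Real.isLittleO_pow_log_id_atTop (n := 8)).bound (c := 1) one_pos
    filter_upwards [tendsto_natCast_atTop_atTop.eventually h] with n hn
    simpa using (le_abs_self _).trans hn
  filter_upwards [h1, h2] with n hL hn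
  have hL1 : 1 ≤ Real.log n := le_trans (by norm_num) hL
  have hK := log_pow_le_mergeParam n
  refine ⟨?_, Nat.ceil_le.2 hn, ?_, ?_⟩
  · have h3 : (10 : ℝ) ^ 12 ≤ mergeParam n := by
      calc (10 : ℝ) ^ 12 ≤ ((10 : ℝ) ^ 8) ^ 8 := by norm_num
        _ ≤ Real.log n ^ 8 := by gcongr
        _ ≤ _ := hK
    exact_mod_cast h3
  · exact Real.exp_one_lt_three.le.trans (le_trans (by norm_num) hL)
  · have h3 : Real.log n ^ 5 ≤ (mergeParam n : ℝ) ^ (2 / 3 : ℝ) := by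
      calc Real.log n ^ 5 = Real.log n ^ (5 : ℝ) := by
            rw [← Real.rpow_natCast]
            norm_num
        _ ≤ Real.log n ^ ((8 : ℝ) * (2 / 3)) :=
          Real.rpow_le_rpow_of_exponent_le hL1 (by norm_num)
        _ = (Real.log n ^ 8) ^ (2 / 3 : ℝ) := by
          rw [Real.rpow_mul (by linarith)]
          norm_cast
        _ ≤ _ := by gcongr
    have h4 : (24000 * Real.log n) ^ 3 ≤ (mergeParam n : ℝ) ^ (2 / 3 : ℝ) / 4 := by
      have h5 : (4 * 24000 ^ 3 : ℝ) ≤ Real.log n ^ 2 := by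
        calc (4 * 24000 ^ 3 : ℝ) ≤ ((10 : ℝ) ^ 8) ^ 2 := by norm_num
          _ ≤ _ := by gcongr
      have h6 : (4 * 24000 ^ 3 : ℝ) * Real.log n ^ 3 ≤ Real.log n ^ 2 * Real.log n ^ 3 := by gcongr
      have h7 : Real.log n ^ 2 * Real.log n ^ 3 = Real.log n ^ 5 := by ring
      rw [mul_pow]
      linarith
    have h8 : 24000 * Real.log n ≤ ((mergeParam n : ℝ) ^ (2 / 3 : ℝ) / 4) ^ (1 / 3 : ℝ) := by
      calc 24000 * Real.log n = ((24000 * Real.log n) ^ 3) ^ (1 / 3 : ℝ) := by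
            rw [← Real.rpow_natCast, ← Real.rpow_mul (by positivity)]
            norm_num
        _ ≤ _ := by gcongr
    linarith

theorem union_bound_le (hn : 1 ≤ n) {r : ℝ} (hr : 15 * Real.log n ≤ r) :
    ((n : ℝ) + 1) ^ 4 * (2 * Real.exp (-r)) ≤ 32 / (n : ℝ) ^ 10 := by
  have hn' : (1 : ℝ) ≤ n := by exact_mod_cast hn
  have hn0 : (0 : ℝ) < n := by linarith
  have h1 : Real.exp (-r) ≤ ((n : ℝ) ^ 15)⁻¹ := by
    rw [Real.exp_neg]
    refine inv_anti₀ (by positivity) ?_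
    calc (n : ℝ) ^ 15 = Real.exp (15 * Real.log n) := by
          rw [mul_comm, Real.exp_mul, Real.exp_log hn0]
          norm_cast
      _ ≤ _ := Real.exp_le_exp.2 hr
  calc ((n : ℝ) + 1) ^ 4 * (2 * Real.exp (-r))
      ≤ ((n : ℝ) + n) ^ 4 * (2 * ((n : ℝ) ^ 15)⁻¹) := by gcongr
    _ = 32 / (n : ℝ) ^ 11 := by field_simp; ring
    _ ≤ _ := div_le_div_of_nonneg_left (by norm_num) (by positivity)
      (pow_le_pow_right₀ hn' (by norm_num))

end Asymptotics

end OnlineSorting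


theorem theorem3 :
    ∃ (C : ℝ) (c : ℕ), ∀ n : ℕ, 1 ≤ n →
      OnlineSorting.streamLaw n
          {x : Fin n → ℝ | ¬ (
            (OnlineSorting.adaptMerge n).cost x ≤ C * Real.log n ^ c ∧
            (OnlineSorting.finalState x).failed = false ∧
            (OnlineSorting.finalState x).last = true ∧
            (∀ b ∈ (OnlineSorting.finalState x).buffers, (b.size : ℝ) ≤ C * Real.log n ^ c) ∧
            ((OnlineSorting.finalState x).poolSize : ℝ) ≤ C * Real.log n ^ c ∧
            ((OnlineSorting.finalState x).phase : ℝ) ≤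
              C * (Real.log n / Real.log (Real.log n)))}
        ≤ ENNReal.ofReal (C / (n : ℝ) ^ 10) := by
  obtain ⟨n₀, hn₀⟩ := Filter.eventually_atTop.1 OnlineSorting.eventually_large
  -- For `n < n₀` the claimed bound on the probability exceeds `1`.
  refine ⟨100 + (n₀ : ℝ) ^ 10, 25, fun n hn => ?_⟩
  have hn' : (0 : ℝ) < n := by exact_mod_cast hn
  rcases lt_or_ge n n₀ with hlt | hge
  · refine MeasureTheory.prob_le_one.trans ?_
    rw [ENNReal.one_le_ofReal, one_le_div (by positivity)]
    have : (n : ℝ) ^ 10 ≤ (n₀ : ℝ) ^ 10 := by gcongr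
    linarith
  · obtain ⟨hK, hKn, hL, hr⟩ := hn₀ n hge
    have hC : (100 : ℝ) ≤ 100 + (n₀ : ℝ) ^ 10 := le_add_of_nonneg_right (by positivity)
    refine (MeasureTheory.measure_mono (t := {x | ¬ OnlineSorting.Good x}) ?_).trans
      ((OnlineSorting.streamLaw_not_good_le hK).trans (ENNReal.ofReal_le_ofReal ?_))
    · intro x hx hg
      exact hx (OnlineSorting.bounds_of_good hg hK hKn hL hC)
    · refine (OnlineSorting.union_bound_le hn hr).trans ?_
      gcongr
      linarith
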